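/- Let $\Gamma$ be a compact metric graph, not necessarily connected: finite sets of vertices and edges (at least one edge; loops and multiple edges allowed), each edge $e$ being a segment $[0,L_e]$ with $0<L_e<\infty$. Let $W\in L^2(\Gamma)$ be a real potential, and let $v$ be a distinguished vertex. For a function $f$ that is $H^2$ on every edge and a vertex $u$ of degree $d_u$ (a loop counts twice), let $F(u),F'(u)\in\mathbb{C}^{d_u}$ be the vectors of values at $u$ of $f$ and of its derivatives, taken into the edges, along the edge ends incident to $u$. At every vertex $u\neq v$ fix an arbitrary self-adjoint vertex condition $A_uF(u)+B_uF'(u)=0$, where $A_u,B_u$ are $d_u\times d_u$ complex matrices such that $(A_u\ B_u)$ has rank $d_u$ and $A_uB_u^*$ is self-adjoint. For $\alpha\in\mathbb{R}$ let $\Gamma_\alpha$ denote the graph with the Hamiltonian $f\mapsto -f''+Wf$ on $L^2(\Gamma)$, whose domain consists of all complex functions $f$ that are $H^2$ on every edge, satisfy the fixed conditions at all $u\ne v$, and satisfy at $v$ the $\delta$-type condition: $f$ is continuous at $v$ and $\sum f'(v)=\alpha f(v)$, where $\sum f'(v)$ is the sum of the entries of $F'(v)$. Let $\Gamma_\infty$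 be defined in the same way with the Dirichlet condition $f(v)=0$ (on all edge ends at $v$) in place of the $\delta$-type condition. Let $-\infty<\alpha<\alpha'\le\infty$. Then, for both $\Gamma_\alpha$ and $\Gamma_{\alpha'}$, the eigenvalues of the Hamiltonian can be listed as an infinite non-decreasing sequence $\lambda_1\le\lambda_2\le\cdots$ of real numbers in which each eigenvalue is repeated according to its multiplicity, and for all $n\ge1$ $$\lambda_n(\Gamma_\alpha)\le\lambda_n(\Gamma_{\alpha'})\le\lambda_{n+1}(\Gamma_\alpha).$$ If moreover $\lambda_n(\Gamma_{\alpha'})$ is a simple eigenvalue and its eigenfunction $f$ satisfies $f(v)\ne0$ or $\sum f'(v)\neq0$, then $$\lambda_n(\Gamma_\alpha)<\lambda_n(\Gamma_{\alpha'})<\lambda_{n+1}(\Gamma_\alpha).$$ -/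

import Mathlib

open MeasureTheory Set

/-- A compact metric graph with vertex set `V` and edge set `E`; loops, multiple edges and several
connected components are allowed. The edge `e` is the segment `[0, len e]`; its end `x = 0` is
attached to the vertex `endpt e false`, its end `x = len e` to `endpt e true`. -/
structure MetricGraph (V E : Type*) where
  endpt : E → Bool → V
  len : E → ℝ
  len_pos : ∀ e, 0 < len e

/-- Vertex conditions `A F + B F' = 0` on the boundary data indexed by `ι` (the edge ends at a
vertex) that are self-adjoint: `(A B)` has maximal rank and `A B*` is Hermitian. -/
structure SelfAdjointCondition (ι : Type*) [Fintype ι] where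
  A : Matrix ι ι ℂ
  B : Matrix ι ι ℂ
  rank_eq : (Matrix.fromCols A B).rank = Fintype.card ι
  hermitian : (A * B.conjTranspose).IsHermitian

namespace MetricGraph

variable {V E : Type*} (Γ : MetricGraph V E)

/-- The edge ends incident to `v`; a loop at `v` contributes two of them. The cardinality is the
degree of `v`. -/
abbrev Star (v : V) : Type _ := {b : E × Bool // Γ.endpt b.1 b.2 = v}

/-- Complex-valued functions on the disjoint union of the closed edges. -/
abbrev Fun : Type _ := (e : E) → Icc (0 : ℝ) (Γ.len e) → ℂ

variable {Γ}

/-- The restriction of `f` to the edge `e`, extended constantly to the whole line. -/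
noncomputable def onEdge (f : Γ.Fun) (e : E) : ℝ → ℂ := IccExtend (Γ.len_pos e).le (f e)

/-- The derivative of `f` in the coordinate of the edge `e` (one-sided at the two ends). -/
noncomputable def edgeDeriv (f : Γ.Fun) (e : E) (x : ℝ) : ℂ :=
  derivWithin (onEdge f e) (Icc 0 (Γ.len e)) x

/-- On `[0, L]`, `f` is absolutely continuous with derivative `g` in `L²(0, L)`; so
`f ∈ H¹(0, L)` with weak derivative `g`, and `f` is the continuous representative. -/
def HasL2Deriv (L : ℝ) (f g : ℝ → ℂ) : Prop :=
  MemLp g 2 (volume.restrict (Ioc 0 L)) ∧ ∀ x ∈ Icc 0 L, f x = f 0 + ∫ t in (0 : ℝ)..x, g t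

/-- On the edge `e`, `f` belongs to `H²(e)` with second derivative `g`. -/
def HasSecondDeriv (f : Γ.Fun) (e : E) (g : ℝ → ℂ) : Prop :=
  DifferentiableOn ℝ (onEdge f e) (Icc 0 (Γ.len e)) ∧ HasL2Deriv (Γ.len e) (edgeDeriv f e) g

/-- The value of `f` at an edge end. -/
noncomputable def endVal (f : Γ.Fun) (b : E × Bool) : ℂ :=
  onEdge f b.1 (if b.2 then Γ.len b.1 else 0)

/-- The derivative of `f` at an edge end, taken away from the vertex and into the edge. -/
noncomputable def endDeriv (f : Γ.Fun) (b : E × Bool) : ℂ :=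
  if b.2 then -edgeDeriv f b.1 (Γ.len b.1) else edgeDeriv f b.1 0

/-- The vector `F(v)`. -/
noncomputable def vertexVal (f : Γ.Fun) (v : V) : Γ.Star v → ℂ := fun b => endVal f b.1

/-- The vector `F'(v)`. -/
noncomputable def vertexDeriv (f : Γ.Fun) (v : V) : Γ.Star v → ℂ := fun b => endDeriv f b.1

theorem onEdge_add (f g : Γ.Fun) (e : E) : onEdge (f + g) e = onEdge f e + onEdge g e := rfl

theorem onEdge_smul (c : ℂ) (f : Γ.Fun) (e : E) : onEdge (c • f) e = c • onEdge f e := rfl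

theorem endpts_mem (e : E) : (0 : ℝ) ∈ Icc 0 (Γ.len e) ∧ Γ.len e ∈ Icc 0 (Γ.len e) :=
  ⟨⟨le_rfl, (Γ.len_pos e).le⟩, ⟨(Γ.len_pos e).le, le_rfl⟩⟩

theorem edgeDeriv_add {f g : Γ.Fun} {e : E} {x : ℝ} (hx : x ∈ Icc 0 (Γ.len e))
    (hf : DifferentiableOn ℝ (onEdge f e) (Icc 0 (Γ.len e)))
    (hg : DifferentiableOn ℝ (onEdge g e) (Icc 0 (Γ.len e))) :
    edgeDeriv (f + g) e x = edgeDeriv f e x + edgeDeriv g e x := by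
  unfold edgeDeriv
  rw [onEdge_add]
  exact derivWithin_add (hf x hx) (hg x hx)

theorem edgeDeriv_smul (c : ℂ) {f : Γ.Fun} {e : E} {x : ℝ} (hx : x ∈ Icc 0 (Γ.len e))
    (hf : DifferentiableOn ℝ (onEdge f e) (Icc 0 (Γ.len e))) :
    edgeDeriv (c • f) e x = c * edgeDeriv f e x := by
  unfold edgeDeriv
  rw [onEdge_smul]
  exact derivWithin_const_smul c (hf x hx)

theorem HasL2Deriv.congr {L : ℝ} (hL : 0 ≤ L) {f f' g : ℝ → ℂ} (h : HasL2Deriv L f g)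
    (hff : ∀ x ∈ Icc 0 L, f' x = f x) : HasL2Deriv L f' g := by
  refine ⟨h.1, fun x hx => ?_⟩
  rw [hff x hx, hff 0 ⟨le_rfl, hL⟩]
  exact h.2 x hx

theorem HasL2Deriv.intervalIntegrable {L : ℝ} {f g : ℝ → ℂ} (h : HasL2Deriv L f g) {x : ℝ}
    (hx : x ∈ Icc 0 L) : IntervalIntegrable g volume 0 x := by
  rw [intervalIntegrable_iff_integrableOn_Ioc_of_le hx.1]
  have : IntegrableOn g (Ioc 0 L) := h.1.integrable (by norm_num)
  exact this.mono_set (Ioc_subset_Ioc_right hx.2)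

theorem HasL2Deriv.add {L : ℝ} {f f' g g' : ℝ → ℂ} (h : HasL2Deriv L f g)
    (h' : HasL2Deriv L f' g') : HasL2Deriv L (f + f') (g + g') := by
  refine ⟨h.1.add h'.1, fun x hx => ?_⟩
  simp only [Pi.add_apply]
  rw [intervalIntegral.integral_add (h.intervalIntegrable hx) (h'.intervalIntegrable hx),
    h.2 x hx, h'.2 x hx]
  ring

theorem HasL2Deriv.smul {L : ℝ} {f g : ℝ → ℂ} (c : ℂ) (h : HasL2Deriv L f g) :
    HasL2Deriv L (c • f) (c • g) := by
  refine ⟨h.1.const_smul c, fun x hx => ?_⟩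
  simp only [Pi.smul_apply]
  rw [intervalIntegral.integral_smul, h.2 x hx, smul_add]

theorem HasSecondDeriv.add {f f' : Γ.Fun} {e : E} {g g' : ℝ → ℂ} (h : HasSecondDeriv f e g)
    (h' : HasSecondDeriv f' e g') : HasSecondDeriv (f + f') e (g + g') :=
  ⟨h.1.add h'.1, (h.2.add h'.2).congr (Γ.len_pos e).le
    fun _ hx => edgeDeriv_add hx h.1 h'.1⟩

theorem HasSecondDeriv.smul (c : ℂ) {f : Γ.Fun} {e : E} {g : ℝ → ℂ} (h : HasSecondDeriv f e g) :
    HasSecondDeriv (c • f) e (c • g) :=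
  ⟨h.1.const_smul c, (h.2.smul c).congr (Γ.len_pos e).le fun _ hx => edgeDeriv_smul c hx h.1⟩

theorem vertexVal_add (f g : Γ.Fun) (v : V) :
    vertexVal (f + g) v = vertexVal f v + vertexVal g v := rfl

theorem vertexVal_smul (c : ℂ) (f : Γ.Fun) (v : V) :
    vertexVal (c • f) v = c • vertexVal f v := rfl

theorem vertexDeriv_add {f g : Γ.Fun}
    (hf : ∀ e, DifferentiableOn ℝ (onEdge f e) (Icc 0 (Γ.len e)))
    (hg : ∀ e, DifferentiableOn ℝ (onEdge g e) (Icc 0 (Γ.len e))) (v : V) :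
    vertexDeriv (f + g) v = vertexDeriv f v + vertexDeriv g v := by
  funext b
  simp only [vertexDeriv, endDeriv, Pi.add_apply]
  split_ifs
  · rw [edgeDeriv_add (endpts_mem _).2 (hf _) (hg _)]
    ring
  · rw [edgeDeriv_add (endpts_mem _).1 (hf _) (hg _)]

theorem vertexDeriv_smul (c : ℂ) {f : Γ.Fun}
    (hf : ∀ e, DifferentiableOn ℝ (onEdge f e) (Icc 0 (Γ.len e))) (v : V) :
    vertexDeriv (c • f) v = c • vertexDeriv f v := by
  funext b
  simp only [vertexDeriv, endDeriv, Pi.smul_apply, smul_eq_mul]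
  split_ifs
  · rw [edgeDeriv_smul c (endpts_mem _).2 (hf _)]
    ring
  · rw [edgeDeriv_smul c (endpts_mem _).1 (hf _)]

variable [Fintype E] [DecidableEq V]

/-- The (extended) `δ`-type condition at `v` with coefficient `α ∈ (-∞, ∞]`: `f` is continuous
at `v` and the sum of its derivatives at `v` is `α f(v)`; for `α = ∞`, `f(v) = 0`. -/
def DeltaCondition (f : Γ.Fun) (v : V) (α : WithTop ℝ) : Prop :=
  (∀ b b' : Γ.Star v, vertexVal f v b = vertexVal f v b') ∧
  match α with
  | none => ∀ b : Γ.Star v, vertexVal f v b = 0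
  | some a => ∀ b : Γ.Star v, ∑ b' : Γ.Star v, vertexDeriv f v b' = (a : ℂ) * vertexVal f v b

/-- All vertex conditions of `Γ_α`: `δ`-type with coefficient `α` at `v`, and the given
self-adjoint conditions at all other vertices. -/
def VertexConditions (v : V) (bc : ∀ u : V, u ≠ v → SelfAdjointCondition (Γ.Star u))
    (α : WithTop ℝ) (f : Γ.Fun) : Prop :=
  DeltaCondition f v α ∧
  ∀ (u : V) (hu : u ≠ v),
    (bc u hu).A.mulVec (vertexVal f u) + (bc u hu).B.mulVec (vertexDeriv f u) = 0

/-- `f` is in the domain of the Hamiltonian `-d²/dx² + W` of `Γ_α` (it is in `H²` on every edge and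
satisfies the vertex conditions) and the Hamiltonian maps `f` to `w` (a.e. on every edge). -/
def HamiltonianMaps (W : E → ℝ → ℝ) (v : V)
    (bc : ∀ u : V, u ≠ v → SelfAdjointCondition (Γ.Star u)) (α : WithTop ℝ)
    (f w : Γ.Fun) : Prop :=
  VertexConditions v bc α f ∧
  ∀ e, ∃ g : ℝ → ℂ, HasSecondDeriv f e g ∧
    ∀ᵐ x ∂volume.restrict (Ioc 0 (Γ.len e)),
      onEdge w e x = -g x + (W e x : ℂ) * onEdge f e x

theorem DeltaCondition.add {f g : Γ.Fun} {v : V} {α : WithTop ℝ}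
    (hd : vertexDeriv (f + g) v = vertexDeriv f v + vertexDeriv g v)
    (hf : DeltaCondition f v α) (hg : DeltaCondition g v α) : DeltaCondition (f + g) v α := by
  refine ⟨fun b b' => ?_, ?_⟩
  · simp only [vertexVal_add, Pi.add_apply]
    rw [hf.1 b b', hg.1 b b']
  · rcases α with _ | a
    · intro b
      have h1 := hf.2 b
      have h2 := hg.2 b
      simp [vertexVal_add, h1, h2]
    · intro b
      have h1 := hf.2 b
      have h2 := hg.2 b
      simp only [hd, vertexVal_add, Pi.add_apply, Finset.sum_add_distrib]
      rw [h1, h2]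
      ring

theorem DeltaCondition.smul (c : ℂ) {f : Γ.Fun} {v : V} {α : WithTop ℝ}
    (hd : vertexDeriv (c • f) v = c • vertexDeriv f v)
    (hf : DeltaCondition f v α) : DeltaCondition (c • f) v α := by
  refine ⟨fun b b' => ?_, ?_⟩
  · simp only [vertexVal_smul, Pi.smul_apply]
    rw [hf.1 b b']
  · rcases α with _ | a
    · intro b
      have h1 := hf.2 b
      simp [vertexVal_smul, h1]
    · intro b
      have h1 := hf.2 b
      simp only [hd, vertexVal_smul, Pi.smul_apply, smul_eq_mul, ← Finset.mul_sum]
      rw [h1]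
      ring

theorem HamiltonianMaps.differentiableOn {W : E → ℝ → ℝ} {v : V}
    {bc : ∀ u : V, u ≠ v → SelfAdjointCondition (Γ.Star u)} {α : WithTop ℝ} {f w : Γ.Fun}
    (h : HamiltonianMaps W v bc α f w) (e : E) :
    DifferentiableOn ℝ (onEdge f e) (Icc 0 (Γ.len e)) := by
  obtain ⟨g, hg, -⟩ := h.2 e
  exact hg.1

theorem HamiltonianMaps.add {W : E → ℝ → ℝ} {v : V}
    {bc : ∀ u : V, u ≠ v → SelfAdjointCondition (Γ.Star u)} {α : WithTop ℝ} {f w f' w' : Γ.Fun}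
    (h : HamiltonianMaps W v bc α f w) (h' : HamiltonianMaps W v bc α f' w') :
    HamiltonianMaps W v bc α (f + f') (w + w') := by
  have hd := vertexDeriv_add h.differentiableOn h'.differentiableOn
  refine ⟨⟨h.1.1.add (hd v) h'.1.1, fun u hu => ?_⟩, fun e => ?_⟩
  · rw [hd, vertexVal_add, Matrix.mulVec_add, Matrix.mulVec_add, add_add_add_comm,
      h.1.2 u hu, h'.1.2 u hu, add_zero]
  · obtain ⟨g, hg, hw⟩ := h.2 e
    obtain ⟨g', hg', hw'⟩ := h'.2 e
    refine ⟨g + g', hg.add hg', ?_⟩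
    filter_upwards [hw, hw'] with x h1 h2
    simp only [onEdge_add, Pi.add_apply, h1, h2]
    ring

theorem HamiltonianMaps.smul (c : ℂ) {W : E → ℝ → ℝ} {v : V}
    {bc : ∀ u : V, u ≠ v → SelfAdjointCondition (Γ.Star u)} {α : WithTop ℝ} {f w : Γ.Fun}
    (h : HamiltonianMaps W v bc α f w) :
    HamiltonianMaps W v bc α (c • f) (c • w) := by
  have hd := vertexDeriv_smul c h.differentiableOn
  refine ⟨⟨h.1.1.smul c (hd v), fun u hu => ?_⟩, fun e => ?_⟩
  · rw [hd, vertexVal_smul, Matrix.mulVec_smul, Matrix.mulVec_smul, ← smul_add,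
      h.1.2 u hu, smul_zero]
  · obtain ⟨g, hg, hw⟩ := h.2 e
    refine ⟨c • g, hg.smul c, ?_⟩
    filter_upwards [hw] with x h1
    simp only [onEdge_smul, Pi.smul_apply, smul_eq_mul, h1]
    ring

theorem HamiltonianMaps.zero (W : E → ℝ → ℝ) (v : V)
    (bc : ∀ u : V, u ≠ v → SelfAdjointCondition (Γ.Star u)) (α : WithTop ℝ) :
    HamiltonianMaps W v bc α (0 : Γ.Fun) 0 := by
  have h0 : ∀ e, onEdge (0 : Γ.Fun) e = 0 := fun _ => rfl
  have h1 : ∀ e, edgeDeriv (0 : Γ.Fun) e = 0 := by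
    intro e
    funext x
    simp [edgeDeriv, h0]
  have h2 : ∀ u, vertexVal (0 : Γ.Fun) u = 0 := fun _ => rfl
  have h3 : ∀ u, vertexDeriv (0 : Γ.Fun) u = 0 := by
    intro u
    funext b
    simp [vertexDeriv, endDeriv, h1]
  refine ⟨⟨⟨fun b b' => by simp [h2], ?_⟩, fun u hu => by simp [h2, h3]⟩, fun e => ?_⟩
  · rcases α with _ | a
    · intro b
      simp [h2]
    · intro b
      simp [h2, h3]
  · refine ⟨0, ⟨?_, MemLp.zero, fun x _ => by simp [h1]⟩, ?_⟩
    · rw [h0]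
      exact differentiableOn_const 0
    · simp [h0]

/-- The eigenspace `{f ∈ D(H) : H f = μ f}` of the Hamiltonian `H = -d²/dx² + W` of `Γ_α`. -/
def eigenspace (W : E → ℝ → ℝ) (v : V)
    (bc : ∀ u : V, u ≠ v → SelfAdjointCondition (Γ.Star u)) (α : WithTop ℝ) (μ : ℂ) :
    Submodule ℂ Γ.Fun where
  carrier := {f | HamiltonianMaps W v bc α f (μ • f)}
  zero_mem' := by
    simpa using HamiltonianMaps.zero W v bc α
  add_mem' := by
    intro f g hf hg
    simpa [smul_add] using HamiltonianMaps.add hf hg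
  smul_mem' := by
    intro c f hf
    simpa [smul_comm c μ f] using HamiltonianMaps.smul c hf

/-- `lam 0 ≤ lam 1 ≤ …` is the list of all eigenvalues of the Hamiltonian of `Γ_α`, each repeated
according to its multiplicity. -/
def IsEigenvalueSequence (W : E → ℝ → ℝ) (v : V)
    (bc : ∀ u : V, u ≠ v → SelfAdjointCondition (Γ.Star u)) (α : WithTop ℝ)
    (lam : ℕ → ℝ) : Prop :=
  Monotone lam ∧
  ∀ μ : ℂ, {n : ℕ | (lam n : ℂ) = μ}.encard
    = Cardinal.toENat (Module.rank ℂ (eigenspace W v bc α μ))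

end MetricGraph

section CompactOperators

open Module End

theorem exists_equiv_nat_monotone {ι : Type*} [Infinite ι] (f : ι → ℝ)
    (hf : ∀ t, {i | f i ≤ t}.Finite) : ∃ σ : ℕ ≃ ι, Monotone (f ∘ σ) := by
  classical
  have hc : Countable ι := by
    have h : (univ : Set ι) = ⋃ n : ℕ, {i | f i ≤ n} := by
      ext i
      simpa using exists_nat_ge (f i)
    rw [← countable_univ_iff, h]
    exact countable_iUnion fun n => (hf n).countable
  obtain ⟨enc, henc⟩ := exists_injective_nat ι
  let key : ι → ℝ ×ₗ ℕ := fun i => toLex (f i, enc i)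
  have hkey : Function.Injective key := fun i j h => henc (congrArg (fun p => (ofLex p).2) h)
  let _ : LinearOrder ι := LinearOrder.lift' key hkey
  have hle : ∀ i j : ι, i ≤ j → f i ≤ f j := by
    intro i j h
    have h' : key i ≤ key j := h
    rcases Prod.Lex.toLex_le_toLex.1 h' with h | h
    · exact h.le
    · exact h.1.le
  have hfin : ∀ i : ι, (Iic i).Finite := fun i => (hf (f i)).subset fun j hj => hle j i hj
  let r : ι → ℕ := fun i => (Iio i).ncard
  have hfin' : ∀ i : ι, (Iio i).Finite := fun i => (hfin i).subset Iio_subset_Iic_self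
  have hr : StrictMono r := by
    intro i j hij
    refine ncard_lt_ncard ⟨Iio_subset_Iio hij.le, fun h => lt_irrefl i (h hij)⟩ (hfin' j)
  have hsurj : Function.Surjective r := by
    intro n
    have hex : ∃ i, n ≤ r i := by
      obtain ⟨i, hi⟩ := (infinite_range_of_injective hr.injective).exists_gt n
      obtain ⟨⟨j, rfl⟩, hj⟩ := hi
      exact ⟨j, hj.le⟩
    obtain ⟨i₀, hi₀⟩ := hex
    let S : Set ι := {i | i ≤ i₀ ∧ n ≤ r i}
    have hS : S.Finite := (hfin i₀).subset fun i hi => hi.1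
    obtain ⟨m, hm, hmin⟩ := hS.exists_minimal ⟨i₀, le_rfl, hi₀⟩
    refine ⟨m, le_antisymm ?_ hm.2⟩
    by_contra hlt
    push Not at hlt
    have hne : (Iio m).Nonempty := by
      rw [← ncard_pos (hfin' m)]
      exact lt_of_le_of_lt (Nat.zero_le _) hlt
    obtain ⟨p, hp, hpmax⟩ := (hfin' m).exists_maximal hne
    have hIio : Iio m = insert p (Iio p) := by
      ext q
      simp only [mem_Iio, mem_insert_iff]
      constructor
      · intro hq
        rcases lt_trichotomy q p with h | h | h
        · exact Or.inr h
        · exact Or.inl h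
        · exact absurd (hpmax hq h.le) (not_le.2 h)
      · rintro (rfl | h)
        · exact hp
        · exact h.trans hp
    have hcard : r m = r p + 1 := by
      change (Iio m).ncard = _
      rw [hIio, ncard_insert_of_notMem (by simp) (hfin' p)]
    have hpS : p ∈ S := ⟨(le_of_lt hp).trans hm.1, by omega⟩
    exact absurd (hmin hpS (le_of_lt hp)) (not_le.2 hp)
  let σ : ι ≃ ℕ := Equiv.ofBijective r ⟨hr.injective, hsurj⟩
  refine ⟨σ.symm, fun a b hab => hle _ _ ?_⟩
  rw [← hr.le_iff_le]
  change σ (σ.symm a) ≤ σ (σ.symm b)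
  simpa using hab

variable {H : Type*} [NormedAddCommGroup H] [InnerProductSpace ℂ H] {T : H →L[ℂ] H}

theorem exists_hilbertBasis_of_card_fiber_eq_finrank [CompleteSpace H] {κ : Type*}
    (hT : IsCompactOperator T)
    (hs : (T : H →ₗ[ℂ] H).IsSymmetric) (τ : κ → ℂ)
    (hfin : ∀ s, FiniteDimensional ℂ (eigenspace (T : End ℂ H) s))
    (hfib : ∀ s, Finite {n // τ n = s})
    (hcard : ∀ s, Nat.card {n // τ n = s} = finrank ℂ (eigenspace (T : End ℂ H) s)) :
    ∃ b : HilbertBasis κ ℂ H, ∀ n, T (b n) = τ n • b n := by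
  classical
  have : ∀ s, Fintype {n // τ n = s} := fun s => Fintype.ofFinite _
  let bs : ∀ s, OrthonormalBasis {n // τ n = s} ℂ (eigenspace (T : End ℂ H) s) := fun s =>
    (stdOrthonormalBasis ℂ (eigenspace (T : End ℂ H) s)).reindex
      (Fintype.equivOfCardEq (by rw [Fintype.card_fin, ← hcard s, Nat.card_eq_fintype_card]))
  let w : κ → H := fun n => (bs (τ n) ⟨n, rfl⟩ : H)
  have hw : Orthonormal ℂ w := by
    have h := hs.orthogonalFamily_eigenspaces.orthonormal_sigma_orthonormal
      (fun s => (bs s).orthonormal)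
    refine h.comp (fun n : κ => (⟨τ n, ⟨n, rfl⟩⟩ : Σ s, {n // τ n = s})) fun a b hab => ?_
    exact congrArg (fun q : Σ s, {n // τ n = s} => q.2.1) hab
  have hspan : (Submodule.span ℂ (range w))ᗮ = ⊥ := by
    rw [eq_bot_iff, ← ContinuousLinearMap.orthogonalComplement_iSup_eigenspaces_eq_bot hT hs]
    apply Submodule.orthogonal_le
    refine iSup_le fun s => ?_
    have h1 : Submodule.map (eigenspace (T : End ℂ H) s).subtype
        (Submodule.span ℂ (range (bs s))) ≤ Submodule.span ℂ (range w) := by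
      rw [Submodule.map_span, Submodule.span_le]
      rintro _ ⟨_, ⟨⟨n, rfl⟩, rfl⟩, rfl⟩
      exact Submodule.subset_span ⟨n, rfl⟩
    have h2 : Submodule.span ℂ (range (bs s)) = ⊤ := by
      rw [← OrthonormalBasis.coe_toBasis]
      exact (bs s).toBasis.span_eq
    rw [h2, Submodule.map_top, Submodule.range_subtype] at h1
    exact h1
  refine ⟨HilbertBasis.mkOfOrthogonalEqBot hw hspan, fun n => ?_⟩
  rw [HilbertBasis.coe_mkOfOrthogonalEqBot]
  exact mem_eigenspace_iff.1 (bs (τ n) ⟨n, rfl⟩).2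

theorem finite_setOf_le_of_orthonormal {ι : Type*} (hT : IsCompactOperator T) {b : ι → H}
    (hb : Orthonormal ℂ b) {τ : ι → ℂ} (hτ : ∀ i, T (b i) = τ i • b i) {t : ℝ} (ht : 0 < t) :
    {i | t ≤ ‖τ i‖}.Finite := by
  by_contra hinf
  obtain ⟨g, hg⟩ : ∃ g : ℕ → ι, Function.Injective g ∧ ∀ n, t ≤ ‖τ (g n)‖ := by
    have := (show {i | t ≤ ‖τ i‖}.Infinite from hinf).to_subtype
    refine ⟨fun n => (Infinite.natEmbedding {i | t ≤ ‖τ i‖} n : ι), ?_, fun n => ?_⟩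
    · exact Subtype.val_injective.comp (Infinite.natEmbedding _).injective
    · exact (Infinite.natEmbedding {i | t ≤ ‖τ i‖} n).2
  obtain ⟨K, hK, hK'⟩ := hT.image_closedBall_subset_compact (𝕜₁ := ℂ) (f := (T : H →ₗ[ℂ] H)) 1
  obtain ⟨y, -, ψ, hψ, hψy⟩ := hK.tendsto_subseq (x := fun n => T (b (g n)))
    (fun n => hK' ⟨b (g n), by simp [hb.1], rfl⟩)
  obtain ⟨N, hN⟩ := Metric.cauchySeq_iff'.1 hψy.cauchySeq t ht
  have h1 := hN (N + 1) (Nat.le_succ N)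
  simp only [Function.comp_apply, dist_eq_norm, hτ] at h1
  have hne : g (ψ (N + 1)) ≠ g (ψ N) := fun h =>
    (hψ (Nat.lt_succ_self N)).ne' (hg.1 h)
  have h2 : ‖τ (g (ψ (N + 1))) • b (g (ψ (N + 1))) - τ (g (ψ N)) • b (g (ψ N))‖ ^ 2
      = ‖τ (g (ψ (N + 1)))‖ ^ 2 + ‖τ (g (ψ N))‖ ^ 2 := by
    rw [@norm_sub_sq ℂ, inner_smul_left, inner_smul_right, hb.2 hne]
    simp [norm_smul, hb.1]
  have h3 := hg.2 (ψ (N + 1))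
  have h4 : t ^ 2 ≤ ‖τ (g (ψ (N + 1)))‖ ^ 2 := by gcongr
  have h5 := pow_lt_pow_left₀ h1 (norm_nonneg _) two_ne_zero
  nlinarith [sq_nonneg ‖τ (g (ψ N))‖]

theorem eigenspace_zero_eq_bot_of_pos (hpos : ∀ x, x ≠ 0 → 0 < (inner ℂ (T x) x).re) :
    eigenspace (T : End ℂ H) 0 = ⊥ := by
  rw [eq_bot_iff]
  intro x hx
  by_contra hne
  have h := hpos x hne
  have h0 : T x = 0 := by simpa using mem_eigenspace_iff.1 hx
  simp [h0] at h

theorem eigenvalue_eq_ofReal_of_pos (hs : (T : H →ₗ[ℂ] H).IsSymmetric)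
    (hpos : ∀ x, x ≠ 0 → 0 < (inner ℂ (T x) x).re)
    {s : ℂ} {x : H} (hx : x ≠ 0) (h : T x = s • x) :
    0 < s.re ∧ (s.re : ℂ) = s := by
  have hev : HasEigenvalue (T : End ℂ H) s :=
    hasEigenvalue_of_hasEigenvector ⟨mem_eigenspace_iff.2 h, hx⟩
  have hconj : (starRingEnd ℂ) s = s := hs.conj_eigenvalue_eq_self hev
  refine ⟨?_, Complex.conj_eq_iff_re.1 hconj⟩
  have h1 := hpos x hx
  rw [h, inner_smul_left, hconj, inner_self_eq_norm_sq_to_K] at h1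
  have h2 : (s * ((‖x‖ : ℂ)) ^ 2).re = s.re * ‖x‖ ^ 2 := by
    rw [← Complex.ofReal_pow, Complex.re_mul_ofReal]
  have h3 : 0 < s.re * ‖x‖ ^ 2 := h2 ▸ h1
  exact pos_of_mul_pos_left h3 (sq_nonneg _)

theorem finiteDimensional_eigenspace_of_pos [CompleteSpace H] (hT : IsCompactOperator T)
    (hpos : ∀ x, x ≠ 0 → 0 < (inner ℂ (T x) x).re) (s : ℂ) :
    FiniteDimensional ℂ (eigenspace (T : End ℂ H) s) := by
  by_cases h : s = 0
  · rw [h, eigenspace_zero_eq_bot_of_pos hpos]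
    infer_instance
  · exact ContinuousLinearMap.finite_dimensional_eigenspace hT s h

/-- The eigenvalues of a compact positive definite operator on an infinite-dimensional Hilbert
space form a non-increasing sequence of positive numbers. -/
theorem exists_antitone_eigenvalues [CompleteSpace H] (hT : IsCompactOperator T)
    (hs : (T : H →ₗ[ℂ] H).IsSymmetric) (hpos : ∀ x, x ≠ 0 → 0 < (inner ℂ (T x) x).re)
    (hH : ¬ FiniteDimensional ℂ H) :
    ∃ τ : ℕ → ℝ, Antitone τ ∧ (∀ n, 0 < τ n) ∧ ∀ s : ℂ, {n : ℕ | (τ n : ℂ) = s}.encard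
      = Cardinal.toENat (Module.rank ℂ (eigenspace (T : End ℂ H) s)) := by
  have hfin := finiteDimensional_eigenspace_of_pos hT hpos
  let I := Σ s : ℂ, Fin (finrank ℂ (eigenspace (T : End ℂ H) s))
  let fibEquiv : ∀ s : ℂ, {i : I // i.1 = s} ≃ Fin (finrank ℂ (eigenspace (T : End ℂ H) s)) :=
    fun s => Equiv.sigmaSubtype s
  have hfib : ∀ s : ℂ, Finite {i : I // i.1 = s} := fun s => Finite.of_equiv _ (fibEquiv s).symm
  have hcard : ∀ s : ℂ, Nat.card {i : I // i.1 = s}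
      = finrank ℂ (eigenspace (T : End ℂ H) s) := by
    intro s
    rw [Nat.card_congr (fibEquiv s), Nat.card_fin]
  obtain ⟨b, hb⟩ := exists_hilbertBasis_of_card_fiber_eq_finrank hT hs (fun i : I => i.1)
    hfin hfib hcard
  have hre : ∀ i : I, 0 < i.1.re ∧ (i.1.re : ℂ) = i.1 := fun i =>
    eigenvalue_eq_ofReal_of_pos hs hpos (b.orthonormal.ne_zero i) (hb i)
  have hI : Infinite I := by
    by_contra hnot
    rw [not_infinite_iff_finite] at hnot
    have := Fintype.ofFinite I
    apply hH
    have h := b.dense_span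
    have hfd : FiniteDimensional ℂ (Submodule.span ℂ (range b)) :=
      FiniteDimensional.span_of_finite ℂ (finite_range b)
    rw [(Submodule.closed_of_finiteDimensional _).submodule_topologicalClosure_eq] at h
    rw [h] at hfd
    exact Submodule.topEquiv.finiteDimensional
  obtain ⟨σ, hσ⟩ := exists_equiv_nat_monotone (fun i : I => (i.1.re)⁻¹) fun t => by
    refine (finite_setOf_le_of_orthonormal hT b.orthonormal hb
      (t := (max t 1)⁻¹) (by positivity)).subset fun i hi => ?_
    have h1 : (i.1.re)⁻¹ ≤ max t 1 := le_trans hi (le_max_left _ _)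
    have h2 : ‖i.1‖ = i.1.re := by
      rw [← (hre i).2, Complex.norm_real, Complex.ofReal_re, Real.norm_of_nonneg (hre i).1.le]
    rw [mem_ofPred_eq, h2]
    exact inv_le_of_inv_le₀ (hre i).1 h1
  refine ⟨fun n => (σ n).1.re, fun m n hmn => ?_, fun n => (hre _).1, fun s => ?_⟩
  · exact (inv_le_inv₀ (hre _).1 (hre _).1).1 (hσ hmn)
  · have h1 : {n : ℕ | (((σ n).1.re : ℝ) : ℂ) = s} = σ ⁻¹' {i : I | i.1 = s} := by
      ext n
      simp only [mem_ofPred_eq, mem_preimage, (hre (σ n)).2]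
    have h2 : Finite ({i : I | i.1 = s} : Set I) := hfib s
    have h3 : Nat.card ({i : I | i.1 = s} : Set I) = _ := hcard s
    rw [h1, ← finrank_eq_rank, Set.encard_preimage_of_bijective σ.bijective,
      Set.encard, ENat.card_eq_coe_natCard, h3]
    simp

theorem exists_hilbertBasis_of_encard_eq_rank [CompleteSpace H] (hT : IsCompactOperator T)
    (hs : (T : H →ₗ[ℂ] H).IsSymmetric) (hpos : ∀ x, x ≠ 0 → 0 < (inner ℂ (T x) x).re) {τ : ℕ → ℝ}
    (hτ : ∀ s : ℂ, {n : ℕ | (τ n : ℂ) = s}.encard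
      = Cardinal.toENat (Module.rank ℂ (eigenspace (T : End ℂ H) s))) :
    ∃ b : HilbertBasis ℕ ℂ H, ∀ n, T (b n) = (τ n : ℂ) • b n := by
  have hfin := finiteDimensional_eigenspace_of_pos hT hpos
  have h1 : ∀ s : ℂ, {n : ℕ | (τ n : ℂ) = s}.encard = finrank ℂ (eigenspace (T : End ℂ H) s) := by
    intro s
    rw [hτ s, ← finrank_eq_rank]
    simp
  have h2 : ∀ s : ℂ, {n : ℕ | (τ n : ℂ) = s}.Finite := fun s => by
    rw [← encard_ne_top_iff, h1 s]
    exact ENat.natCast_ne_top _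
  refine exists_hilbertBasis_of_card_fiber_eq_finrank hT hs (fun n => (τ n : ℂ)) hfin
    (fun s => (h2 s).to_subtype) fun s => ?_
  have h3 := h1 s
  rw [← (h2 s).cast_ncard_eq] at h3
  exact_mod_cast h3

theorem HilbertBasis.re_inner_le_of_forall_lt {b : HilbertBasis ℕ ℂ H} {τ : ℕ → ℝ}
    (hs : (T : H →ₗ[ℂ] H).IsSymmetric) (hb : ∀ n, T (b n) = (τ n : ℂ) • b n) (hτ : Antitone τ)
    {n : ℕ} {g : H} (hg : ∀ i < n, inner ℂ (b i) g = 0) :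
    (inner ℂ (T g) g).re ≤ τ n * ‖g‖ ^ 2 := by
  have key : ∀ i, inner ℂ g (b i) * inner ℂ (b i) g = ((‖inner ℂ (b i) g‖ ^ 2 : ℝ) : ℂ) := by
    intro i
    rw [← inner_conj_symm, RCLike.conj_mul]
    push_cast
    rfl
  have h1 : HasSum (fun i => τ i * ‖inner ℂ (b i) g‖ ^ 2) (inner ℂ (T g) g).re := by
    have h := Complex.hasSum_re (b.hasSum_inner_mul_inner (T g) g)
    have h' : ∀ i, inner ℂ (T g) (b i) * inner ℂ (b i) g
        = ((τ i * ‖inner ℂ (b i) g‖ ^ 2 : ℝ) : ℂ) := by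
      intro i
      have hsi : inner ℂ (T g) (b i) = inner ℂ g (T (b i)) := hs g (b i)
      rw [hsi, hb, inner_smul_right, mul_assoc, key]
      push_cast
      rfl
    simpa only [h', Complex.ofReal_re] using h
  have h2 : HasSum (fun i => ‖inner ℂ (b i) g‖ ^ 2) (‖g‖ ^ 2) := by
    have h := Complex.hasSum_re (b.hasSum_inner_mul_inner g g)
    simp only [key, Complex.ofReal_re] at h
    rwa [inner_self_eq_norm_sq_to_K, ← RCLike.ofReal_pow] at h
  refine hasSum_le (fun i => ?_) h1 (h2.mul_left (τ n))
  by_cases hi : i < n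
  · simp [hg i hi]
  · exact mul_le_mul_of_nonneg_right (hτ (not_lt.1 hi)) (sq_nonneg _)

theorem Orthonormal.mul_norm_sq_le_re_inner_sum {b : ℕ → H} {τ : ℕ → ℝ} (ho : Orthonormal ℂ b)
    (hb : ∀ n, T (b n) = (τ n : ℂ) • b n) (hτ : Antitone τ) {n : ℕ} (c : Fin (n + 1) → ℂ) :
    τ n * ‖∑ i, c i • b i‖ ^ 2 ≤ (inner ℂ (T (∑ i, c i • b i)) (∑ i, c i • b i)).re := by
  have ho' : Orthonormal ℂ (fun i : Fin (n + 1) => b i) := ho.comp _ Fin.val_injective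
  have h1 : T (∑ i, c i • b i) = ∑ i : Fin (n + 1), (τ i * c i) • b i := by
    simp only [map_sum, map_smul, hb, smul_smul, mul_comm]
  have key : ∀ z : ℂ, (starRingEnd ℂ) z * z = ((‖z‖ ^ 2 : ℝ) : ℂ) := fun z => by
    rw [RCLike.conj_mul]
    push_cast
    rfl
  have h2 : (inner ℂ (T (∑ i, c i • b i)) (∑ i, c i • b i)).re
      = ∑ i : Fin (n + 1), τ i * ‖c i‖ ^ 2 := by
    rw [h1, ho'.inner_sum, Complex.re_sum]
    refine Finset.sum_congr rfl fun i _ => ?_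
    rw [map_mul, Complex.conj_ofReal, mul_assoc, key, ← Complex.ofReal_mul, Complex.ofReal_re]
  have h3 : ‖∑ i, c i • b i‖ ^ 2 = ∑ i : Fin (n + 1), ‖c i‖ ^ 2 := by
    have h := congrArg Complex.re (ho'.inner_sum c c Finset.univ)
    rw [inner_self_eq_norm_sq_to_K] at h
    simp only [key, Complex.re_sum, Complex.ofReal_re] at h
    rw [← h]
    norm_cast
  rw [h2, h3, Finset.mul_sum]
  exact Finset.sum_le_sum fun i _ =>
    mul_le_mul_of_nonneg_right (hτ (Nat.lt_succ_iff.1 i.2)) (sq_nonneg _)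

/-- If the form of `T'` is bounded by that of `T` on a subspace of codimension at most `m`, then
`τ' (n + m) ≤ τ n` for the eigenvalues in non-increasing order. -/
theorem eigenvalue_le_of_form_le {T' : H →L[ℂ] H} {b b' : HilbertBasis ℕ ℂ H} {τ τ' : ℕ → ℝ}
    (hs : (T : H →ₗ[ℂ] H).IsSymmetric) (hb : ∀ n, T (b n) = (τ n : ℂ) • b n) (hτ : Antitone τ)
    (hb' : ∀ n, T' (b' n) = (τ' n : ℂ) • b' n) (hτ' : Antitone τ') {m : ℕ}
    (φ : H →ₗ[ℂ] (Fin m → ℂ))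
    (h : ∀ g, φ g = 0 → (inner ℂ (T' g) g).re ≤ (inner ℂ (T g) g).re) (n : ℕ) :
    τ' (n + m) ≤ τ n := by
  let comb : (Fin (n + m + 1) → ℂ) →ₗ[ℂ] H :=
    Fintype.linearCombination ℂ (fun i : Fin (n + m + 1) => b' i)
  let ψ : H →ₗ[ℂ] (Fin n → ℂ) := LinearMap.pi fun i => (innerSL ℂ (b i) : H →ₗ[ℂ] ℂ)
  have hker : ((ψ.prod φ).comp comb).ker ≠ ⊥ := by
    apply LinearMap.ker_ne_bot_of_finrank_lt
    simp
  obtain ⟨c, hc, hc0⟩ := Submodule.exists_mem_ne_zero_of_ne_bot hker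
  have hcomb : comb c = ∑ i, c i • b' i := Fintype.linearCombination_apply ..
  have hc1 : ψ (comb c) = 0 := congrArg Prod.fst hc
  have hc2 : φ (comb c) = 0 := congrArg Prod.snd hc
  have hg0 : comb c ≠ 0 := by
    intro h0
    have hli : LinearIndependent ℂ (fun i : Fin (n + m + 1) => b' i) :=
      (b'.orthonormal.comp _ Fin.val_injective).linearIndependent
    rw [hcomb] at h0
    exact hc0 (funext (Fintype.linearIndependent_iff.1 hli c h0))
  have h1 := b'.orthonormal.mul_norm_sq_le_re_inner_sum hb' hτ' c
  rw [← hcomb] at h1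
  have h2 := HilbertBasis.re_inner_le_of_forall_lt hs hb hτ (n := n) (g := comb c)
    fun i hi => congrFun hc1 ⟨i, hi⟩
  have h3 := h _ hc2
  have h4 : 0 < ‖comb c‖ ^ 2 := by positivity
  exact le_of_mul_le_mul_right (h1.trans (h3.trans h2)) h4

end CompactOperators

section IntervalSpaces

open scoped BoundedContinuousFunction ComplexConjugate

/-- The space `L²(0, L)`. -/
abbrev SegL2 (L : ℝ) : Type := Lp ℂ 2 (volume.restrict (Ioc (0 : ℝ) L))

/-- Continuous functions on `[0, L]` with the supremum norm. -/
abbrev SegC (L : ℝ) : Type := Icc (0 : ℝ) L →ᵇ ℂ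

theorem AbsolutelyContinuousOnInterval.congr_on {X : Type*} [PseudoMetricSpace X] {f g : ℝ → X}
    {a b : ℝ} (hf : AbsolutelyContinuousOnInterval f a b) (h : ∀ x ∈ uIcc a b, f x = g x) :
    AbsolutelyContinuousOnInterval g a b := by
  rw [absolutelyContinuousOnInterval_iff] at hf ⊢
  intro ε hε
  obtain ⟨δ, hδ, hδ'⟩ := hf ε hε
  refine ⟨δ, hδ, fun I hI hlt => ?_⟩
  have h1 := hδ' I hI hlt
  rwa [Finset.sum_congr rfl fun i hi => by rw [h _ (hI.1 i hi).1, h _ (hI.1 i hi).2]] at h1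

theorem IntervalIntegrable.absolutelyContinuousOnInterval_integral_complex {g : ℝ → ℂ} {a b : ℝ}
    (hg : IntervalIntegrable g volume a b) :
    AbsolutelyContinuousOnInterval (fun x => ∫ t in a..x, g t) a b := by
  have hre : IntervalIntegrable (fun t => (g t).re) volume a b := ⟨hg.1.re, hg.2.re⟩
  have him : IntervalIntegrable (fun t => (g t).im) volume a b := ⟨hg.1.im, hg.2.im⟩
  have hconst : ∀ z : ℂ, AbsolutelyContinuousOnInterval (fun _ : ℝ => z) a b := fun z =>
    (LipschitzWith.const z).lipschitzOnWith.absolutelyContinuousOnInterval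
  have h := ((hre.absolutelyContinuousOnInterval_intervalIntegral left_mem_uIcc).smul
    (hconst 1)).add ((him.absolutelyContinuousOnInterval_intervalIntegral left_mem_uIcc).smul
    (hconst Complex.I))
  refine h.congr_on fun x hx => ?_
  have hsub : uIcc a x ⊆ uIcc a b := uIcc_subset_uIcc_left hx
  have hgx := hg.mono_set hsub
  have h1 := (Complex.reCLM.intervalIntegral_comp_comm hgx)
  have h2 := (Complex.imCLM.intervalIntegral_comp_comm hgx)
  simp only [Complex.reCLM_apply, Complex.imCLM_apply] at h1 h2
  simp only [Pi.add_apply, Pi.smul_apply', h1, h2, Complex.real_smul, mul_one]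
  exact Complex.re_add_im _

theorem integral_mul_add_mul_eq_sub {p q g h : ℝ → ℂ} {a b : ℝ} (hab : a ≤ b)
    (hg : IntervalIntegrable g volume a b) (hh : IntervalIntegrable h volume a b)
    (hp : ∀ x ∈ Icc a b, p x = p a + ∫ t in a..x, g t)
    (hq : ∀ x ∈ Icc a b, q x = q a + ∫ t in a..x, h t) :
    ∫ x in a..b, (g x * q x + p x * h x) = p b * q b - p a * q a := by
  have hconst : ∀ z : ℂ, AbsolutelyContinuousOnInterval (fun _ : ℝ => z) a b := fun z =>
    (LipschitzWith.const z).lipschitzOnWith.absolutelyContinuousOnInterval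
  let P : ℝ → ℂ := fun x => p a + ∫ t in a..x, g t
  let Q : ℝ → ℂ := fun x => q a + ∫ t in a..x, h t
  have hP : AbsolutelyContinuousOnInterval P a b :=
    (hconst (p a)).add hg.absolutelyContinuousOnInterval_integral_complex
  have hQ : AbsolutelyContinuousOnInterval Q a b :=
    (hconst (q a)).add hh.absolutelyContinuousOnInterval_integral_complex
  have hint : IntervalIntegrable (fun x => g x * Q x + P x * h x) volume a b :=
    (hg.mul_continuousOn hQ.continuousOn).add (hh.continuousOn_mul hP.continuousOn)
  have hD := (hP.smul hQ).sub hint.absolutelyContinuousOnInterval_integral_complex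
  obtain ⟨C, hC⟩ := hD.const_of_ae_hasDerivAt_zero (by
    filter_upwards [hg.ae_hasDerivAt_integral, hh.ae_hasDerivAt_integral,
      hint.ae_hasDerivAt_integral] with x h1 h2 h3 hx
    have h4 := (((h1 hx a left_mem_uIcc).const_add (p a)).mul
      ((h2 hx a left_mem_uIcc).const_add (q a))).sub (h3 hx a left_mem_uIcc)
    rw [sub_self] at h4
    exact h4)
  have ha := hC a left_mem_uIcc
  have hb := hC b right_mem_uIcc
  have hPb : P b = p b := (hp b ⟨hab, le_rfl⟩).symm
  have hQb : Q b = q b := (hq b ⟨hab, le_rfl⟩).symm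
  have hPa : P a = p a := by simp [P]
  have hQa : Q a = q a := by simp [Q]
  simp only [Pi.sub_apply, smul_eq_mul, Pi.mul_apply, hPb, hQb, hPa, hQa,
    intervalIntegral.integral_same, sub_zero] at ha hb
  have hcongr : ∫ x in a..b, (g x * Q x + P x * h x) = ∫ x in a..b, (g x * q x + p x * h x) := by
    refine intervalIntegral.integral_congr fun x hx => ?_
    rw [uIcc_of_le hab] at hx
    rw [hp x hx, hq x hx]
  rw [← hcongr]
  linear_combination ha - hb

variable {L : ℝ}

theorem intervalIntegrable_of_mem_Icc (g : SegL2 L) {x y : ℝ} (hx : x ∈ Icc 0 L)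
    (hy : y ∈ Icc 0 L) : IntervalIntegrable g volume x y := by
  have h : IntegrableOn g (Ioc 0 L) := (Lp.memLp g).integrable (by norm_num)
  rw [intervalIntegrable_iff]
  refine h.mono_set fun t ht => ?_
  rw [uIoc, mem_Ioc] at ht
  exact ⟨lt_of_le_of_lt (le_min hx.1 hy.1) ht.1, ht.2.trans (max_le hx.2 hy.2)⟩

theorem norm_integral_le_sqrt_mul (g : SegL2 L) {x y : ℝ} (hx : x ∈ Icc 0 L) (hy : y ∈ Icc 0 L) :
    ‖∫ t in x..y, g t‖ ≤ √|y - x| * ‖g‖ := by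
  wlog hxy : x ≤ y generalizing x y
  · rw [intervalIntegral.integral_symm, norm_neg, abs_sub_comm]
    exact this hy hx (le_of_not_ge hxy)
  have hsub : Ioc x y ⊆ Ioc 0 L := Ioc_subset_Ioc hx.1 hy.2
  have hμ : (volume.restrict (Ioc 0 L)) (Ioc x y) ≠ ⊤ := by
    rw [Measure.restrict_apply measurableSet_Ioc, inter_eq_left.2 hsub]
    simp
  have h1 : ∫ t in x..y, g t = inner ℂ (indicatorConstLp 2 measurableSet_Ioc hμ (1 : ℂ)) g := by
    rw [L2.inner_indicatorConstLp_one, Measure.restrict_restrict measurableSet_Ioc,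
      inter_eq_left.2 hsub, intervalIntegral.integral_of_le hxy]
  have h2 : (volume.restrict (Ioc 0 L)).real (Ioc x y) = y - x := by
    rw [measureReal_restrict_apply measurableSet_Ioc, inter_eq_left.2 hsub]
    simp [hxy]
  rw [h1]
  refine (norm_inner_le_norm _ _).trans (mul_le_mul_of_nonneg_right ?_ (norm_nonneg _))
  rw [norm_indicatorConstLp (by norm_num) (by norm_num), h2, abs_of_nonneg (sub_nonneg.2 hxy),
    Real.sqrt_eq_rpow]
  simp

theorem zero_mem_of_mem {x : ℝ} (hx : x ∈ Icc 0 L) : (0 : ℝ) ∈ Icc 0 L :=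
  ⟨le_rfl, hx.1.trans hx.2⟩

theorem norm_integral_sub_le (g : SegL2 L) {x y : ℝ} (hx : x ∈ Icc 0 L) (hy : y ∈ Icc 0 L) :
    ‖(∫ t in 0..y, g t) - ∫ t in 0..x, g t‖ ≤ √|y - x| * ‖g‖ := by
  rw [intervalIntegral.integral_interval_sub_left
    (intervalIntegrable_of_mem_Icc g (zero_mem_of_mem hx) hy)
    (intervalIntegrable_of_mem_Icc g (zero_mem_of_mem hx) hx)]
  exact norm_integral_le_sqrt_mul g hx hy

theorem integral_congr_ae_of_mem {g g' : ℝ → ℂ} (h : g =ᵐ[volume.restrict (Ioc 0 L)] g') {x : ℝ}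
    (hx : x ∈ Icc 0 L) : ∫ t in 0..x, g t = ∫ t in 0..x, g' t := by
  rw [intervalIntegral.integral_of_le hx.1, intervalIntegral.integral_of_le hx.1]
  exact integral_congr_ae (ae_mono (Measure.restrict_mono (Ioc_subset_Ioc_right hx.2) le_rfl) h)

/-- The primitive `x ↦ ∫₀ˣ g` of a square integrable function. -/
noncomputable def primitiveₗ (L : ℝ) : SegL2 L →ₗ[ℂ] SegC L where
  toFun g := BoundedContinuousFunction.mkOfCompact ⟨fun x => ∫ t in (0 : ℝ)..x, g t, by
    rw [continuous_iff_continuousAt]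
    intro x
    rw [ContinuousAt, tendsto_iff_norm_sub_tendsto_zero]
    refine squeeze_zero (fun _ => norm_nonneg _)
      (fun y => norm_integral_sub_le g x.2 y.2) ?_
    have : Continuous fun y : Icc (0 : ℝ) L => √|(y : ℝ) - x| * ‖g‖ := by fun_prop
    simpa using this.tendsto x⟩
  map_add' g h := by
    ext x
    change ∫ t in (0 : ℝ)..x, (g + h : SegL2 L) t
      = (∫ t in (0 : ℝ)..x, g t) + ∫ t in (0 : ℝ)..x, h t
    rw [integral_congr_ae_of_mem (Lp.coeFn_add g h) x.2, ← intervalIntegral.integral_add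
      (intervalIntegrable_of_mem_Icc g (zero_mem_of_mem x.2) x.2)
      (intervalIntegrable_of_mem_Icc h (zero_mem_of_mem x.2) x.2)]
    rfl
  map_smul' c g := by
    ext x
    change ∫ t in (0 : ℝ)..x, (c • g : SegL2 L) t = c • ∫ t in (0 : ℝ)..x, g t
    rw [integral_congr_ae_of_mem (Lp.coeFn_smul c g) x.2, ← intervalIntegral.integral_smul]
    rfl

theorem isCompactOperator_primitiveₗ (L : ℝ) : IsCompactOperator (primitiveₗ L) := by
  rw [isCompactOperator_iff_isCompact_closure_image_closedBall _ one_pos]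
  refine BoundedContinuousFunction.arzela_ascoli (Metric.closedBall 0 (√|L|))
    (isCompact_closedBall _ _) _ ?_ ?_
  · rintro _ x ⟨g, hg, rfl⟩
    rw [mem_closedBall_zero_iff] at hg ⊢
    have h := norm_integral_le_sqrt_mul g (zero_mem_of_mem x.2) x.2
    refine h.trans ?_
    rw [sub_zero, abs_of_nonneg x.2.1, ← mul_one √|L|]
    exact mul_le_mul (Real.sqrt_le_sqrt (x.2.2.trans (le_abs_self L))) hg (norm_nonneg _)
      (Real.sqrt_nonneg _)
  · refine Metric.equicontinuous_of_continuity_modulus (fun r => √|r|) ?_ _ ?_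
    · have : Continuous fun r : ℝ => √|r| := by fun_prop
      simpa using this.tendsto 0
    · rintro x y ⟨_, g, hg, rfl⟩
      rw [mem_closedBall_zero_iff] at hg
      rw [dist_eq_norm, Subtype.dist_eq, Real.dist_eq, abs_abs]
      have h := norm_integral_sub_le g y.2 x.2
      exact h.trans (mul_le_of_le_one_right (Real.sqrt_nonneg _) hg)

/-- The compact operator `L²(0, L) → C[0, L]` of integration from `0`. -/
noncomputable def primitive (L : ℝ) : SegL2 L →L[ℂ] SegC L :=
  ContinuousLinearMap.mkOfIsCompactOperator (isCompactOperator_primitiveₗ L)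

theorem isCompactOperator_primitive (L : ℝ) : IsCompactOperator (primitive L) :=
  isCompactOperator_primitiveₗ L

theorem primitive_apply (g : SegL2 L) (x : Icc (0 : ℝ) L) :
    primitive L g x = ∫ t in (0 : ℝ)..x, g t := rfl

/-- Constant functions on `[0, L]`. -/
noncomputable def constC (L : ℝ) : ℂ →L[ℂ] SegC L :=
  (ContinuousLinearMap.id ℂ ℂ).smulRight (BoundedContinuousFunction.const _ 1)

theorem constC_apply (c : ℂ) (x : Icc (0 : ℝ) L) : constC L c x = c := by
  simp [constC]

variable (hL : 0 ≤ L)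

theorem memLp_mul_IccExtend {w : ℝ → ℂ} (hw : MemLp w 2 (volume.restrict (Ioc 0 L))) (h : SegC L) :
    MemLp (fun x => w x * IccExtend hL h x) 2 (volume.restrict (Ioc 0 L)) := by
  refine hw.of_le_mul (c := ‖h‖) (hw.1.mul ?_) ?_
  · exact (h.continuous.Icc_extend' (h := hL)).aestronglyMeasurable
  · refine Filter.Eventually.of_forall fun x => ?_
    rw [norm_mul, mul_comm]
    gcongr
    exact h.norm_coe_le_norm _

/-- Multiplication by a fixed square integrable function, from `C[0, L]` to `L²(0, L)`. -/
noncomputable def mulL2 (w : ℝ → ℂ) (hw : MemLp w 2 (volume.restrict (Ioc 0 L))) :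
    SegC L →L[ℂ] SegL2 L :=
  LinearMap.mkContinuous
    { toFun := fun h => (memLp_mul_IccExtend hL hw h).toLp
      map_add' := fun h k => by
        rw [← MemLp.toLp_add]
        refine MemLp.toLp_congr _ _ (Filter.Eventually.of_forall fun x => ?_)
        exact mul_add _ _ _
      map_smul' := fun c h => by
        rw [RingHom.id_apply, ← MemLp.toLp_const_smul]
        refine MemLp.toLp_congr _ _ (Filter.Eventually.of_forall fun x => ?_)
        exact mul_left_comm _ _ _ } ‖hw.toLp‖ fun h => by
    rw [mul_comm]
    refine Lp.norm_le_mul_norm_of_ae_le_mul ?_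
    filter_upwards [(memLp_mul_IccExtend hL hw h).coeFn_toLp, hw.coeFn_toLp] with x h1 h2
    simp only [LinearMap.coe_mk, AddHom.coe_mk]
    rw [h1, h2, norm_mul, mul_comm]
    gcongr
    exact h.norm_coe_le_norm _

theorem coeFn_mulL2 (w : ℝ → ℂ) (hw : MemLp w 2 (volume.restrict (Ioc 0 L))) (h : SegC L) :
    mulL2 hL w hw h =ᵐ[volume.restrict (Ioc 0 L)] fun x => w x * IccExtend hL h x :=
  (memLp_mul_IccExtend hL hw h).coeFn_toLp

/-- The inclusion of `C[0, L]` into `L²(0, L)`. -/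
noncomputable def inclL2 : SegC L →L[ℂ] SegL2 L := mulL2 hL (fun _ => 1) (memLp_const 1)

theorem coeFn_inclL2 (h : SegC L) :
    inclL2 hL h =ᵐ[volume.restrict (Ioc 0 L)] IccExtend hL h := by
  filter_upwards [coeFn_mulL2 hL (fun _ => 1) (memLp_const 1) h] with x hx
  rw [inclL2, hx, one_mul]

/-- The function on `[0, L]` with value `a` at `0` and derivative `p`. -/
noncomputable def affinePrimitive (a : ℂ) (p : SegL2 L) : SegC L := constC L a + primitive L p

theorem affinePrimitive_apply (a : ℂ) (p : SegL2 L) (x : Icc (0 : ℝ) L) :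
    affinePrimitive a p x = a + ∫ t in (0 : ℝ)..x, p t := by
  rw [affinePrimitive, BoundedContinuousFunction.add_apply, constC_apply, primitive_apply]

theorem IccExtend_affinePrimitive (a : ℂ) (p : SegL2 L) {x : ℝ} (hx : x ∈ Icc 0 L) :
    IccExtend hL (affinePrimitive a p) x
      = IccExtend hL (affinePrimitive a p) 0 + ∫ t in (0 : ℝ)..x, p t := by
  rw [IccExtend_of_mem hL _ hx, IccExtend_of_mem hL _ ⟨le_rfl, hL⟩, affinePrimitive_apply,
    affinePrimitive_apply]
  simp

theorem inner_inclL2_eq_integral (h : SegC L) (q : SegL2 L) :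
    inner ℂ (inclL2 hL h) q = ∫ x in (0 : ℝ)..L, conj (IccExtend hL h x) * q x := by
  rw [L2.inner_def, intervalIntegral.integral_of_le hL]
  refine integral_congr_ae ?_
  filter_upwards [coeFn_inclL2 hL h] with x hx
  rw [hx, RCLike.inner_apply, mul_comm]

/-- Integration by parts. -/
theorem inner_inclL2_affinePrimitive (a b : ℂ) (p q : SegL2 L) :
    inner ℂ (inclL2 hL (affinePrimitive a p)) q
      = conj (affinePrimitive a p ⟨L, hL, le_rfl⟩) * affinePrimitive b q ⟨L, hL, le_rfl⟩
        - conj (affinePrimitive a p ⟨0, le_rfl, hL⟩) * affinePrimitive b q ⟨0, le_rfl, hL⟩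
        - inner ℂ p (inclL2 hL (affinePrimitive b q)) := by
  have h0 : (0 : ℝ) ∈ Icc 0 L := ⟨le_rfl, hL⟩
  have hLm : L ∈ Icc 0 L := ⟨hL, le_rfl⟩
  have hp := intervalIntegrable_of_mem_Icc p h0 hLm
  have hq := intervalIntegrable_of_mem_Icc q h0 hLm
  have hp' : IntervalIntegrable (fun x => conj (p x)) volume 0 L := by
    rw [intervalIntegrable_iff] at hp ⊢
    exact Complex.conjCLE.toContinuousLinearMap.integrable_comp hp
  have hPc : Continuous (IccExtend hL (affinePrimitive a p)) :=
    (affinePrimitive a p).continuous.Icc_extend'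
  have hQc : Continuous (IccExtend hL (affinePrimitive b q)) :=
    (affinePrimitive b q).continuous.Icc_extend'
  have h := integral_mul_add_mul_eq_sub hL hp' hq
    (p := fun x => conj (IccExtend hL (affinePrimitive a p) x))
    (q := IccExtend hL (affinePrimitive b q)) (fun x hx => by
      rw [IccExtend_affinePrimitive hL a p hx, map_add]
      congr 1
      rw [intervalIntegral.integral_of_le hx.1, intervalIntegral.integral_of_le hx.1,
        integral_conj])
    (fun x hx => IccExtend_affinePrimitive hL b q hx)
  rw [intervalIntegral.integral_add (hp'.mul_continuousOn hQc.continuousOn)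
    (hq.continuousOn_mul (by fun_prop)), ← inner_inclL2_eq_integral] at h
  have h2 : inner ℂ p (inclL2 hL (affinePrimitive b q))
      = ∫ x in (0 : ℝ)..L, conj (p x) * IccExtend hL (affinePrimitive b q) x := by
    rw [L2.inner_def, intervalIntegral.integral_of_le hL]
    refine integral_congr_ae ?_
    filter_upwards [coeFn_inclL2 hL (affinePrimitive b q)] with x hx
    rw [hx, RCLike.inner_apply, mul_comm]
  rw [h2, eq_sub_iff_add_eq, add_comm, h, IccExtend_of_mem hL _ h0, IccExtend_of_mem hL _ hLm,
    IccExtend_of_mem hL _ h0, IccExtend_of_mem hL _ hLm]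

theorem norm_inclL2_sq (h : SegC L) :
    ‖inclL2 hL h‖ ^ 2 = ∫ x in (0 : ℝ)..L, ‖IccExtend hL h x‖ ^ 2 := by
  have h1 := inner_inclL2_eq_integral hL h (inclL2 hL h)
  have h2 : ∫ x in (0 : ℝ)..L, conj (IccExtend hL h x) * inclL2 hL h x
      = ∫ x in (0 : ℝ)..L, ((‖IccExtend hL h x‖ ^ 2 : ℝ) : ℂ) := by
    rw [intervalIntegral.integral_of_le hL, intervalIntegral.integral_of_le hL]
    refine integral_congr_ae ?_
    filter_upwards [coeFn_inclL2 hL h] with x hx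
    rw [hx, RCLike.conj_mul]
    push_cast
    rfl
  rw [h2, intervalIntegral.integral_ofReal, inner_self_eq_norm_sq_to_K] at h1
  apply Complex.ofReal_injective
  rw [← h1]
  push_cast
  rfl

theorem norm_affinePrimitive_apply_sq_le (a : ℂ) (p : SegL2 L) (x : Icc (0 : ℝ) L) {δ : ℝ}
    (hδ : 0 < δ) (hδL : δ ≤ L) : ‖affinePrimitive a p x‖ ^ 2
      ≤ 2 / δ * ‖inclL2 hL (affinePrimitive a p)‖ ^ 2 + 2 * δ * ‖p‖ ^ 2 := by
  set F := affinePrimitive a p with hF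
  have hFc : Continuous (IccExtend hL F) := F.continuous.Icc_extend'
  set s := min (x : ℝ) (L - δ) with hs
  have hs0 : 0 ≤ s := le_min x.2.1 (by linarith)
  have hsL : s + δ ≤ L := by
    have := min_le_right (x : ℝ) (L - δ)
    linarith
  have hsx : s ≤ x := min_le_left _ _
  have hxs : (x : ℝ) ≤ s + δ := by
    rcases min_choice (x : ℝ) (L - δ) with h | h
    · rw [hs, h]
      linarith
    · rw [hs, h]
      linarith [x.2.2]
  have hpt : ∀ t ∈ Icc s (s + δ), ‖F x‖ ^ 2 ≤ 2 * ‖IccExtend hL F t‖ ^ 2 + 2 * δ * ‖p‖ ^ 2 := by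
    intro t ht
    have htm : t ∈ Icc 0 L := ⟨hs0.trans ht.1, ht.2.trans hsL⟩
    have h1 : ‖F x - IccExtend hL F t‖ ≤ √δ * ‖p‖ := by
      rw [IccExtend_of_mem hL _ htm, hF, affinePrimitive_apply, affinePrimitive_apply,
        add_sub_add_left_eq_sub]
      refine (norm_integral_sub_le p htm x.2).trans ?_
      gcongr
      rw [abs_le]
      constructor <;> linarith [ht.1, ht.2]
    have h2 : ‖F x‖ ≤ ‖IccExtend hL F t‖ + √δ * ‖p‖ := by
      have := norm_sub_norm_le (F x) (IccExtend hL F t)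
      linarith
    have h3 : ‖F x‖ ^ 2 ≤ (‖IccExtend hL F t‖ + √δ * ‖p‖) ^ 2 := by gcongr
    have h4 : (√δ * ‖p‖) ^ 2 = δ * ‖p‖ ^ 2 := by rw [mul_pow, Real.sq_sqrt hδ.le]
    nlinarith [sq_nonneg (‖IccExtend hL F t‖ - √δ * ‖p‖)]
  have hint : δ * ‖F x‖ ^ 2
      ≤ ∫ t in s..(s + δ), (2 * ‖IccExtend hL F t‖ ^ 2 + 2 * δ * ‖p‖ ^ 2) := by
    have h := intervalIntegral.integral_mono_on (μ := volume) (a := s) (b := s + δ)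
      (f := fun _ => ‖F x‖ ^ 2) (g := fun t => 2 * ‖IccExtend hL F t‖ ^ 2 + 2 * δ * ‖p‖ ^ 2)
      (by linarith) (Continuous.intervalIntegrable (by fun_prop) _ _)
      (Continuous.intervalIntegrable (by fun_prop) _ _) hpt
    simpa using h
  rw [intervalIntegral.integral_add (Continuous.intervalIntegrable (by fun_prop) _ _)
    (Continuous.intervalIntegrable (by fun_prop) _ _), intervalIntegral.integral_const_mul,
    intervalIntegral.integral_const, smul_eq_mul, add_sub_cancel_left] at hint
  have hmono : ∫ t in s..(s + δ), ‖IccExtend hL F t‖ ^ 2 ≤ ‖inclL2 hL F‖ ^ 2 := by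
    rw [norm_inclL2_sq]
    exact intervalIntegral.integral_mono_interval hs0 (by linarith) hsL
      (Filter.Eventually.of_forall fun t => by positivity)
      (Continuous.intervalIntegrable (by fun_prop) _ _)
  have hfin : δ * ‖F x‖ ^ 2 ≤ δ * (2 / δ * ‖inclL2 hL F‖ ^ 2 + 2 * δ * ‖p‖ ^ 2) := by
    have : δ * (2 / δ * ‖inclL2 hL F‖ ^ 2 + 2 * δ * ‖p‖ ^ 2)
        = 2 * ‖inclL2 hL F‖ ^ 2 + δ * (2 * δ * ‖p‖ ^ 2) := by
      field_simp
    rw [this]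
    linarith
  exact le_of_mul_le_mul_left hfin hδ

theorem norm_mulL2_apply_le (w : ℝ → ℂ) (hw : MemLp w 2 (volume.restrict (Ioc 0 L))) (h : SegC L) :
    ‖mulL2 hL w hw h‖ ≤ ‖hw.toLp‖ * ‖h‖ :=
  ContinuousLinearMap.le_of_opNorm_le _
    (LinearMap.mkContinuous_norm_le _ (norm_nonneg _) _) h

/-- Boundary values and the potential are form bounded with respect to the Dirichlet integral. -/
theorem exists_forall_boundary_le_form (hpos : 0 < L) (w : ℝ → ℂ)
    (hw : MemLp w 2 (volume.restrict (Ioc 0 L))) {C : ℝ} (hC : 0 ≤ C) :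
    ∃ κ₀ : ℝ, ∀ κ ≥ κ₀, ∀ (a : ℂ) (p : SegL2 L),
      C * (‖affinePrimitive a p ⟨0, le_rfl, hL⟩‖ ^ 2 + ‖affinePrimitive a p ⟨L, hL, le_rfl⟩‖ ^ 2)
        + ‖inclL2 hL (affinePrimitive a p)‖ ^ 2
      ≤ ‖p‖ ^ 2 + (inner ℂ (inclL2 hL (affinePrimitive a p))
          (mulL2 hL w hw (affinePrimitive a p))).re
        + κ * ‖inclL2 hL (affinePrimitive a p)‖ ^ 2 := by
  set δ := min L (1 / (2 * (2 * C + 1))) with hδdef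
  have hδ : 0 < δ := lt_min hpos (by positivity)
  have hδ2 : 2 * δ * (2 * C + 1) ≤ 1 := by
    have h := min_le_right L (1 / (2 * (2 * C + 1)))
    rw [← hδdef, le_div_iff₀ (by positivity)] at h
    linarith
  refine ⟨1 + ‖hw.toLp‖ ^ 2 / 2 + (2 * C + 1) * (2 / δ), fun κ hκ a p => ?_⟩
  set F := affinePrimitive a p with hF
  set N := ‖inclL2 hL F‖
  have hsq : ∀ x, ‖F x‖ ^ 2 ≤ ‖F‖ ^ 2 := fun x => by
    gcongr
    exact F.norm_coe_le_norm x
  have htr : ‖F‖ ^ 2 ≤ 2 / δ * N ^ 2 + 2 * δ * ‖p‖ ^ 2 := by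
    have hnn : 0 ≤ 2 / δ * N ^ 2 + 2 * δ * ‖p‖ ^ 2 := by positivity
    have h1 : ‖F‖ ≤ √(2 / δ * N ^ 2 + 2 * δ * ‖p‖ ^ 2) := by
      refine (F.norm_le (Real.sqrt_nonneg _)).2 fun x => ?_
      exact Real.le_sqrt_of_sq_le
        (norm_affinePrimitive_apply_sq_le hL a p x hδ (min_le_left _ _))
    calc ‖F‖ ^ 2 ≤ (√(2 / δ * N ^ 2 + 2 * δ * ‖p‖ ^ 2)) ^ 2 := by gcongr
      _ = _ := Real.sq_sqrt hnn
  have hin : -(N * (‖hw.toLp‖ * ‖F‖)) ≤ (inner ℂ (inclL2 hL F) (mulL2 hL w hw F)).re := by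
    have h1 := (Complex.abs_re_le_norm _).trans
      (norm_inner_le_norm (𝕜 := ℂ) (inclL2 hL F) (mulL2 hL w hw F))
    have h2 : N * ‖mulL2 hL w hw F‖ ≤ N * (‖hw.toLp‖ * ‖F‖) := by
      gcongr
      exact norm_mulL2_apply_le hL w hw F
    linarith [(abs_le.1 (h1.trans h2)).1]
  have h3 := sq_nonneg (N * ‖hw.toLp‖ - ‖F‖)
  have h4 : (2 * C + 1) * ‖F‖ ^ 2
      ≤ (2 * C + 1) * (2 / δ) * N ^ 2 + ‖p‖ ^ 2 := by
    have h5 := mul_le_mul_of_nonneg_left htr (show 0 ≤ 2 * C + 1 by positivity)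
    have h6 := mul_le_mul_of_nonneg_right hδ2 (sq_nonneg ‖p‖)
    nlinarith
  have h7 : (1 + ‖hw.toLp‖ ^ 2 / 2 + (2 * C + 1) * (2 / δ)) * N ^ 2 ≤ κ * N ^ 2 := by
    gcongr
  have h8 := mul_le_mul_of_nonneg_left (hsq ⟨0, le_rfl, hL⟩) hC
  have h9 := mul_le_mul_of_nonneg_left (hsq ⟨L, hL, le_rfl⟩) hC
  nlinarith [sq_nonneg ‖F‖]

theorem hasDerivWithinAt_affinePrimitive_inclL2 (c : ℂ) (D : SegC L) {x : ℝ}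
    (hx : x ∈ Icc 0 L) :
    HasDerivWithinAt (IccExtend hL (affinePrimitive c (inclL2 hL D))) (IccExtend hL D x)
      (Icc 0 L) x := by
  have hDc : Continuous (IccExtend hL D) := D.continuous.Icc_extend'
  have h1 : HasDerivAt (fun u => c + ∫ t in (0 : ℝ)..u, IccExtend hL D t) (IccExtend hL D x) x :=
    (hDc.integral_hasStrictDerivAt 0 x).hasDerivAt.const_add c
  have h2 : ∀ y ∈ Icc 0 L, IccExtend hL (affinePrimitive c (inclL2 hL D)) y
      = c + ∫ t in (0 : ℝ)..y, IccExtend hL D t := by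
    intro y hy
    rw [IccExtend_of_mem hL _ hy, affinePrimitive_apply,
      integral_congr_ae_of_mem (coeFn_inclL2 hL D) hy]
  exact h1.hasDerivWithinAt.congr h2 (h2 x hx)

theorem eq_affinePrimitive_of_hasL2Deriv {f g : ℝ → ℂ}
    (hf : DifferentiableOn ℝ f (Icc 0 L))
    (hg : MetricGraph.HasL2Deriv L (derivWithin f (Icc 0 L)) g) (x : Icc (0 : ℝ) L) :
    f x = affinePrimitive (f 0)
      (inclL2 hL (affinePrimitive (derivWithin f (Icc 0 L) 0) hg.1.toLp)) x := by
  set D := affinePrimitive (derivWithin f (Icc 0 L) 0) hg.1.toLp with hD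
  have hDc : Continuous (IccExtend hL D) := D.continuous.Icc_extend'
  have hDx : ∀ y ∈ Icc 0 L, derivWithin f (Icc 0 L) y = IccExtend hL D y := by
    intro y hy
    rw [hg.2 y hy, IccExtend_of_mem hL _ hy, hD, affinePrimitive_apply,
      integral_congr_ae_of_mem hg.1.coeFn_toLp hy]
  have hsub : uIcc 0 (x : ℝ) ⊆ Icc 0 L := by
    rw [uIcc_of_le x.2.1]
    exact Icc_subset_Icc_right x.2.2
  have h1 : ∫ t in (0 : ℝ)..x, IccExtend hL D t = f x - f 0 := by
    refine intervalIntegral.integral_eq_sub_of_hasDeriv_right (hf.continuousOn.mono hsub) ?_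
      (hDc.intervalIntegrable _ _)
    intro y hy
    rw [min_eq_left x.2.1, max_eq_right x.2.1] at hy
    have hy' : y ∈ Ioo 0 L := ⟨hy.1, hy.2.trans_le x.2.2⟩
    rw [← hDx y (Ioo_subset_Icc_self hy')]
    exact ((hf y (Ioo_subset_Icc_self hy')).hasDerivWithinAt.hasDerivAt
      (Icc_mem_nhds hy'.1 hy'.2)).hasDerivWithinAt
  rw [affinePrimitive_apply, integral_congr_ae_of_mem (coeFn_inclL2 hL D) x.2, h1]
  ring

theorem not_finiteDimensional_segL2 (hpos : 0 < L) : ¬ FiniteDimensional ℂ (SegL2 L) := by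
  intro hfd
  let ev : Polynomial ℂ →ₗ[ℂ] SegL2 L :=
    { toFun := fun q => inclL2 hpos.le (BoundedContinuousFunction.mkOfCompact
        ⟨fun x : Icc (0 : ℝ) L => q.eval ((x : ℝ) : ℂ), by fun_prop⟩)
      map_add' := fun q r => by
        rw [← map_add]
        congr 1
        ext x
        exact Polynomial.eval_add
      map_smul' := fun c q => by
        rw [RingHom.id_apply, ← map_smul]
        congr 1
        ext x
        exact Polynomial.eval_smul c q _ }
  have hinj : Function.Injective ev := by
    rw [← LinearMap.ker_eq_bot, eq_bot_iff]
    intro q hq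
    rw [LinearMap.mem_ker] at hq
    have h1 : ∀ᵐ x ∂volume.restrict (Ioc 0 L), q.eval ((x : ℝ) : ℂ) = 0 := by
      have h2 := coeFn_inclL2 hpos.le (BoundedContinuousFunction.mkOfCompact
        ⟨fun x : Icc (0 : ℝ) L => q.eval ((x : ℝ) : ℂ), by fun_prop⟩)
      have h3 : (ev q : ℝ → ℂ) =ᵐ[volume.restrict (Ioc 0 L)] 0 := by
        rw [hq]
        exact Lp.coeFn_zero _ _ _
      filter_upwards [h2, h3, ae_restrict_mem measurableSet_Ioc] with x hx hx' hmem
      rw [IccExtend_of_mem hpos.le _ (Ioc_subset_Icc_self hmem)] at hx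
      exact hx.symm.trans hx'
    rw [ae_restrict_iff' measurableSet_Ioc] at h1
    have hinf : {x : ℝ | x ∈ Ioc 0 L ∧ q.eval (x : ℂ) = 0}.Infinite := by
      intro hfin
      have h4 : volume (Ioc 0 L) ≤ volume {x : ℝ | x ∈ Ioc 0 L ∧ q.eval (x : ℂ) = 0} := by
        refine measure_mono_ae ?_
        filter_upwards [h1] with x hx hmem using ⟨hmem, hx hmem⟩
      rw [hfin.measure_zero, Real.volume_Ioc] at h4
      simp [hpos.not_ge] at h4
    refine Polynomial.eq_zero_of_infinite_isRoot q
      ((hinf.image Complex.ofReal_injective.injOn).mono ?_)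
    rintro _ ⟨x, hx, rfl⟩
    exact hx.2
  have h5 : FiniteDimensional ℂ (Polynomial ℂ) := Module.Finite.of_injective ev hinj
  exact Polynomial.not_finite h5

end IntervalSpaces

section VertexConditions

open scoped ComplexConjugate ComplexOrder

variable {ι : Type*} [Fintype ι]

namespace SelfAdjointCondition

theorem exists_eq_of_condition (S : SelfAdjointCondition ι) {F F' : ι → ℂ}
    (h : S.A.mulVec F + S.B.mulVec F' = 0) :
    ∃ c, F = -S.B.conjTranspose.mulVec c ∧ F' = S.A.conjTranspose.mulVec c := by
  classical
  set M := Matrix.fromCols S.A S.B with hM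
  let P : (ι → ℂ) →ₗ[ℂ] (ι ⊕ ι → ℂ) :=
    (Matrix.fromRows (-S.B.conjTranspose) S.A.conjTranspose).mulVecLin
  have hMv : ∀ u u' : ι → ℂ, M.mulVec (Sum.elim u u') = S.A.mulVec u + S.B.mulVec u' := by
    intro u u'
    rw [hM, Matrix.fromCols_mulVec]
    simp
  have hPc : ∀ c, P c = Sum.elim (-S.B.conjTranspose.mulVec c) (S.A.conjTranspose.mulVec c) := by
    intro c
    simp [P, Matrix.fromRows_mulVec, Matrix.neg_mulVec]
  have hBA : S.B * S.A.conjTranspose = S.A * S.B.conjTranspose := by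
    have := S.hermitian
    rwa [Matrix.IsHermitian, Matrix.conjTranspose_mul, Matrix.conjTranspose_conjTranspose] at this
  have hle : LinearMap.range P ≤ LinearMap.ker M.mulVecLin := by
    rintro _ ⟨c, rfl⟩
    rw [LinearMap.mem_ker, Matrix.mulVecLin_apply, hPc, hMv, Matrix.mulVec_neg,
      Matrix.mulVec_mulVec, Matrix.mulVec_mulVec, hBA]
    simp
  have hMinj : Function.Injective M.conjTranspose.mulVecLin := by
    rw [← LinearMap.ker_eq_bot]
    have h1 := M.conjTranspose.mulVecLin.finrank_range_add_finrank_ker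
    have h2 : Module.finrank ℂ (LinearMap.range M.conjTranspose.mulVecLin) = Fintype.card ι := by
      rw [← S.rank_eq, ← Matrix.rank_conjTranspose]
      rfl
    rw [h2, Module.finrank_fintype_fun_eq_card] at h1
    exact Submodule.finrank_eq_zero.1 (by omega)
  have hPinj : Function.Injective P := by
    rw [← LinearMap.ker_eq_bot, eq_bot_iff]
    intro c hc
    rw [LinearMap.mem_ker, hPc] at hc
    have h1 : S.B.conjTranspose.mulVec c = 0 := by
      funext i
      simpa using congrFun hc (Sum.inl i)
    have h2 : S.A.conjTranspose.mulVec c = 0 := by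
      funext i
      simpa using congrFun hc (Sum.inr i)
    refine hMinj ?_
    rw [map_zero, Matrix.mulVecLin_apply, hM, Matrix.conjTranspose_fromCols_eq_fromRows_conjTranspose,
      Matrix.fromRows_mulVec, h1, h2]
    funext i
    cases i <;> rfl
  have heq : LinearMap.range P = LinearMap.ker M.mulVecLin := by
    refine Submodule.eq_of_le_of_finrank_eq hle ?_
    have h1 := M.mulVecLin.finrank_range_add_finrank_ker
    have h2 : Module.finrank ℂ (LinearMap.range M.mulVecLin) = Fintype.card ι := S.rank_eq
    rw [h2, Module.finrank_fintype_fun_eq_card, Fintype.card_sum] at h1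
    rw [LinearMap.finrank_range_of_inj hPinj, Module.finrank_fintype_fun_eq_card]
    omega
  have hmem : Sum.elim F F' ∈ LinearMap.range P := by
    rw [heq, LinearMap.mem_ker, Matrix.mulVecLin_apply, hMv, h]
  obtain ⟨c, hc⟩ := hmem
  rw [hPc] at hc
  refine ⟨c, ?_, ?_⟩
  · funext i
    exact (congrFun hc (Sum.inl i)).symm
  · funext i
    exact (congrFun hc (Sum.inr i)).symm

theorem sum_mul_conj_eq (S : SelfAdjointCondition ι) {F F' G G' : ι → ℂ}
    (h : S.A.mulVec F + S.B.mulVec F' = 0) (h' : S.A.mulVec G + S.B.mulVec G' = 0) :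
    ∑ b, F' b * conj (G b) = ∑ b, F b * conj (G' b) := by
  obtain ⟨c, rfl, rfl⟩ := S.exists_eq_of_condition h
  obtain ⟨d, rfl, rfl⟩ := S.exists_eq_of_condition h'
  have hBA : S.B * S.A.conjTranspose = S.A * S.B.conjTranspose := by
    have := S.hermitian
    rwa [Matrix.IsHermitian, Matrix.conjTranspose_mul, Matrix.conjTranspose_conjTranspose] at this
  have key : ∀ X Y : Matrix ι ι ℂ, ∑ b, X.conjTranspose.mulVec c b
      * conj (Y.conjTranspose.mulVec d b) = dotProduct (star d) ((Y * X.conjTranspose).mulVec c) := by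
    intro X Y
    rw [← Matrix.mulVec_mulVec, Matrix.dotProduct_mulVec]
    have : Matrix.vecMul (star d) Y = star (Y.conjTranspose.mulVec d) := by
      rw [Matrix.star_mulVec, Matrix.conjTranspose_conjTranspose]
    rw [this, dotProduct]
    exact Finset.sum_congr rfl fun b _ => mul_comm _ _
  simp only [Pi.neg_apply, map_neg, mul_neg, neg_mul, Finset.sum_neg_distrib]
  rw [key, key, hBA]

theorem exists_abs_re_sum_le (S : SelfAdjointCondition ι) :
    ∃ C : ℝ, 0 ≤ C ∧ ∀ F F' : ι → ℂ, S.A.mulVec F + S.B.mulVec F' = 0 →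
      |(∑ b, F' b * conj (F b)).re| ≤ C * ∑ b, ‖F b‖ ^ 2 := by
  classical
  let N : ((ι → ℂ) × (ι → ℂ)) →ₗ[ℂ] (ι → ℂ) := S.A.mulVecLin.coprod S.B.mulVecLin
  let π : LinearMap.ker N →ₗ[ℂ] (ι → ℂ) := (LinearMap.fst ℂ _ _).comp (LinearMap.ker N).subtype
  obtain ⟨s, hs⟩ := π.rangeRestrict.exists_rightInverse_of_surjective π.range_rangeRestrict
  obtain ⟨r, hr⟩ := ((LinearMap.snd ℂ (ι → ℂ) (ι → ℂ)).comp
    ((LinearMap.ker N).subtype.comp s)).exists_extend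
  let rc : (ι → ℂ) →L[ℂ] (ι → ℂ) := LinearMap.toContinuousLinearMap r
  refine ⟨Fintype.card ι * ‖rc‖, by positivity, fun F F' h => ?_⟩
  have hmem : (F, F') ∈ LinearMap.ker N := h
  have hF : F ∈ LinearMap.range π := ⟨⟨(F, F'), hmem⟩, rfl⟩
  have hsF : ((s ⟨F, hF⟩ : (ι → ℂ) × (ι → ℂ)).1) = F :=
    congrArg Subtype.val (LinearMap.congr_fun hs ⟨F, hF⟩)
  have hrF : r F = (s ⟨F, hF⟩ : (ι → ℂ) × (ι → ℂ)).2 := LinearMap.congr_fun hr ⟨F, hF⟩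
  have hcond : S.A.mulVec F + S.B.mulVec (r F) = 0 := by
    have h1 : S.A.mulVec (s ⟨F, hF⟩ : (ι → ℂ) × (ι → ℂ)).1
      + S.B.mulVec (s ⟨F, hF⟩ : (ι → ℂ) × (ι → ℂ)).2 = 0 := (s ⟨F, hF⟩).2
    rwa [hsF, ← hrF] at h1
  have heq : ∑ b, F' b * conj (F b) = ∑ b, r F b * conj (F b) := by
    have h1 := S.sum_mul_conj_eq h hcond
    have h2 := S.sum_mul_conj_eq hcond hcond
    rw [h1, h2]
  rw [heq]
  refine (Complex.abs_re_le_norm _).trans ((norm_sum_le _ _).trans ?_)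
  have hb : ∀ b, ‖r F b * conj (F b)‖ ≤ ‖rc‖ * ∑ b, ‖F b‖ ^ 2 := by
    intro b
    have h1 : ‖r F b‖ ≤ ‖rc‖ * ‖F‖ := (norm_le_pi_norm _ b).trans (rc.le_opNorm F)
    have h2 : ‖F b‖ ≤ ‖F‖ := norm_le_pi_norm F b
    have h3 : ‖F‖ ^ 2 ≤ ∑ b, ‖F b‖ ^ 2 := by
      have hnn : 0 ≤ ∑ b, ‖F b‖ ^ 2 := by positivity
      have : ‖F‖ ≤ √(∑ b, ‖F b‖ ^ 2) := (pi_norm_le_iff_of_nonneg (Real.sqrt_nonneg _)).2 fun i =>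
        Real.le_sqrt_of_sq_le
          (Finset.single_le_sum (f := fun b => ‖F b‖ ^ 2) (fun _ _ => sq_nonneg _)
            (Finset.mem_univ i))
      calc ‖F‖ ^ 2 ≤ (√(∑ b, ‖F b‖ ^ 2)) ^ 2 := by gcongr
        _ = _ := Real.sq_sqrt hnn
    rw [norm_mul, RCLike.norm_conj]
    calc ‖r F b‖ * ‖F b‖ ≤ ‖rc‖ * ‖F‖ * ‖F‖ := by gcongr
      _ = ‖rc‖ * ‖F‖ ^ 2 := by ring
      _ ≤ _ := by gcongr
  calc ∑ b, ‖r F b * conj (F b)‖ ≤ ∑ _b : ι, ‖rc‖ * ∑ b, ‖F b‖ ^ 2 :=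
        Finset.sum_le_sum fun b _ => hb b
    _ = _ := by
        rw [Finset.sum_const, nsmul_eq_mul, Finset.card_univ]
        ring

end SelfAdjointCondition

end VertexConditions

section IntervalInjectivity

variable {L : ℝ}

theorem inclL2_injective (hpos : 0 < L) : Function.Injective (inclL2 hpos.le) := by
  rw [injective_iff_map_eq_zero]
  intro h hh
  have h1 : IccExtend hpos.le h =ᵐ[volume.restrict (Icc 0 L)] fun _ => (0 : ℂ) := by
    rw [← restrict_Ioc_eq_restrict_Icc]
    refine (coeFn_inclL2 hpos.le h).symm.trans ?_
    rw [hh]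
    exact Lp.coeFn_zero _ _ _
  have h2 := Measure.eqOn_Icc_of_ae_eq volume hpos.ne h1
    (h.continuous.Icc_extend' (h := hpos.le)).continuousOn continuousOn_const
  ext x
  have h3 := h2 x.2
  rwa [IccExtend_of_mem hpos.le _ x.2] at h3

theorem primitive_injective (hL : 0 ≤ L) : Function.Injective (primitive L) := by
  rw [injective_iff_map_eq_zero]
  intro g hg
  have h0 : ∀ x ∈ Icc 0 L, ∫ t in (0 : ℝ)..x, g t = 0 := fun x hx =>
    (primitive_apply g ⟨x, hx⟩).symm.trans (by rw [hg]; rfl)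
  have hint := intervalIntegrable_of_mem_Icc g ⟨le_rfl, hL⟩ ⟨hL, le_rfl⟩
  rw [Lp.eq_zero_iff_ae_eq_zero, Filter.EventuallyEq, ae_restrict_iff' measurableSet_Ioc]
  filter_upwards [hint.ae_hasDerivAt_integral, Measure.ae_ne volume L] with x hx hxL hmem'
  have hmem : x ∈ Ioo 0 L := ⟨hmem'.1, lt_of_le_of_ne hmem'.2 hxL⟩
  have h1 := hx (by rw [uIcc_of_le hL]; exact Ioo_subset_Icc_self hmem) 0 left_mem_uIcc
  have h2 : (fun u => ∫ t in (0 : ℝ)..u, g t) =ᶠ[nhds x] fun _ => 0 := by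
    filter_upwards [Icc_mem_nhds hmem.1 hmem.2] with u hu using h0 u hu
  exact h1.unique ((hasDerivAt_const x (0 : ℂ)).congr_of_eventuallyEq h2)

end IntervalInjectivity

namespace MetricGraph

open scoped ComplexConjugate BoundedContinuousFunction

variable {V E : Type*} (Γ : MetricGraph V E)

/-- The Hilbert space `L²(Γ)`. -/
abbrev L2 : Type _ := PiLp 2 fun e => SegL2 (Γ.len e)

/-- Data `(f(0), f'(0))` for each edge together with `f''`, parametrizing the functions that are
`H²` on every edge. -/
abbrev H2Data : Type _ := (E × Bool → ℂ) × Γ.L2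

variable {Γ}

/-- The derivative on the edge `e` of the function with the given data. -/
noncomputable def derivC (e : E) : Γ.H2Data →L[ℂ] SegC (Γ.len e) :=
  (constC (Γ.len e)).comp
      ((ContinuousLinearMap.proj (R := ℂ) (φ := fun _ : E × Bool => ℂ) (e, true)).comp
        (ContinuousLinearMap.fst ℂ _ _))
    + (primitive (Γ.len e)).comp
      ((PiLp.proj (𝕜 := ℂ) 2 (fun e => SegL2 (Γ.len e)) e).comp (ContinuousLinearMap.snd ℂ _ _))

/-- The values on the edge `e` of the function with the given data. -/
noncomputable def valC (e : E) : Γ.H2Data →L[ℂ] SegC (Γ.len e) :=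
  (constC (Γ.len e)).comp
      ((ContinuousLinearMap.proj (R := ℂ) (φ := fun _ : E × Bool => ℂ) (e, false)).comp
        (ContinuousLinearMap.fst ℂ _ _))
    + (primitive (Γ.len e)).comp ((inclL2 (Γ.len_pos e).le).comp (derivC e))

theorem derivC_apply (e : E) (y : Γ.H2Data) :
    derivC e y = affinePrimitive (y.1 (e, true)) (y.2 e) := rfl

theorem valC_apply (e : E) (y : Γ.H2Data) :
    valC e y = affinePrimitive (y.1 (e, false)) (inclL2 (Γ.len_pos e).le (derivC e y)) := rfl

theorem isCompactOperator_valC (e : E) : IsCompactOperator (valC (Γ := Γ) e) := by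
  refine IsCompactOperator.add ?_ ?_
  · exact (isCompactOperator_of_locallyCompactSpace_rng (constC (Γ.len e))).comp_clm _
  · exact (isCompactOperator_primitive (Γ.len e)).comp_clm _

/-- The function on the graph with the given data. -/
noncomputable def ofData : Γ.H2Data →ₗ[ℂ] Γ.Fun where
  toFun y := fun e x => valC e y x
  map_add' y z := by
    funext e x
    simp
  map_smul' c y := by
    funext e x
    simp

theorem onEdge_ofData (y : Γ.H2Data) (e : E) :
    onEdge (ofData y) e = IccExtend (Γ.len_pos e).le (valC e y) := rfl

theorem hasDerivWithinAt_onEdge_ofData (y : Γ.H2Data) (e : E) {x : ℝ} (hx : x ∈ Icc 0 (Γ.len e)) :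
    HasDerivWithinAt (onEdge (ofData y) e) (IccExtend (Γ.len_pos e).le (derivC e y) x)
      (Icc 0 (Γ.len e)) x :=
  hasDerivWithinAt_affinePrimitive_inclL2 (Γ.len_pos e).le _ _ hx

theorem edgeDeriv_ofData (y : Γ.H2Data) (e : E) {x : ℝ} (hx : x ∈ Icc 0 (Γ.len e)) :
    edgeDeriv (ofData y) e x = IccExtend (Γ.len_pos e).le (derivC e y) x :=
  (hasDerivWithinAt_onEdge_ofData y e hx).derivWithin
    (uniqueDiffOn_Icc (Γ.len_pos e) x hx)

theorem hasSecondDeriv_ofData (y : Γ.H2Data) (e : E) : HasSecondDeriv (ofData y) e (y.2 e) := by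
  refine ⟨fun x hx => (hasDerivWithinAt_onEdge_ofData y e hx).differentiableWithinAt,
    Lp.memLp _, fun x hx => ?_⟩
  rw [edgeDeriv_ofData y e hx, edgeDeriv_ofData y e (endpts_mem e).1, derivC_apply]
  exact IccExtend_affinePrimitive (Γ.len_pos e).le _ _ hx

theorem exists_ofData_eq {f : Γ.Fun} {g : E → ℝ → ℂ} (h : ∀ e, HasSecondDeriv f e (g e)) :
    ∃ y : Γ.H2Data, ofData y = f ∧ ∀ e, y.2 e =ᵐ[volume.restrict (Ioc 0 (Γ.len e))] g e := by
  let y : Γ.H2Data := (fun b => if b.2 then edgeDeriv f b.1 0 else onEdge f b.1 0,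
    WithLp.toLp 2 fun e => (h e).2.1.toLp)
  refine ⟨y, ?_, fun e => (h e).2.1.coeFn_toLp⟩
  funext e x
  have h1 := eq_affinePrimitive_of_hasL2Deriv (Γ.len_pos e).le (h e).1 (h e).2 x
  have h2 : onEdge f e x = f e x := IccExtend_val _ _ x
  rw [h2] at h1
  exact h1.symm

/-- The position of an edge end on its edge. -/
noncomputable def endPoint (Γ : MetricGraph V E) (b : E × Bool) : Icc (0 : ℝ) (Γ.len b.1) :=
  if b.2 then ⟨Γ.len b.1, (endpts_mem b.1).2⟩ else ⟨0, (endpts_mem b.1).1⟩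

/-- Values at the edge ends. -/
noncomputable def endValL : Γ.H2Data →L[ℂ] (E × Bool → ℂ) :=
  ContinuousLinearMap.pi fun b =>
    (BoundedContinuousFunction.evalCLM ℂ (endPoint Γ b)).comp (valC b.1)

/-- Inward derivatives at the edge ends. -/
noncomputable def endDerivL : Γ.H2Data →L[ℂ] (E × Bool → ℂ) :=
  ContinuousLinearMap.pi fun b =>
    (if b.2 then -1 else 1 : ℂ) •
      (BoundedContinuousFunction.evalCLM ℂ (endPoint Γ b)).comp (derivC b.1)

theorem endDerivL_apply (y : Γ.H2Data) (b : E × Bool) :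
    endDerivL y b = (if b.2 then -1 else 1 : ℂ) * derivC b.1 y (endPoint Γ b) := rfl

theorem endVal_ofData (y : Γ.H2Data) (b : E × Bool) : endVal (ofData y) b = endValL y b := by
  obtain ⟨e, _ | _⟩ := b
  · exact IccExtend_of_mem (Γ.len_pos e).le _ (endpts_mem e).1
  · exact IccExtend_of_mem (Γ.len_pos e).le _ (endpts_mem e).2

theorem endDeriv_ofData (y : Γ.H2Data) (b : E × Bool) : endDeriv (ofData y) b = endDerivL y b := by
  obtain ⟨e, _ | _⟩ := b
  · rw [endDerivL_apply]
    simp only [endDeriv, endPoint, Bool.false_eq_true, if_false, one_mul]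
    rw [edgeDeriv_ofData y e (endpts_mem e).1]
    exact IccExtend_of_mem (Γ.len_pos e).le _ (endpts_mem e).1
  · rw [endDerivL_apply]
    simp only [endDeriv, endPoint, if_true, neg_mul, one_mul]
    rw [edgeDeriv_ofData y e (endpts_mem e).2]
    exact congrArg Neg.neg (IccExtend_of_mem (Γ.len_pos e).le _ (endpts_mem e).2)

/-- The inclusion of `H²` functions into `L²(Γ)`. -/
noncomputable def toL2 : Γ.H2Data →L[ℂ] Γ.L2 :=
  ((PiLp.continuousLinearEquiv 2 ℂ fun e => SegL2 (Γ.len e)).symm :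
      ((e : E) → SegL2 (Γ.len e)) →L[ℂ] Γ.L2).comp
    (ContinuousLinearMap.pi fun e => (inclL2 (Γ.len_pos e).le).comp (valC e))

theorem toL2_apply (y : Γ.H2Data) (e : E) : toL2 y e = inclL2 (Γ.len_pos e).le (valC e y) := rfl

theorem toL2_injective : Function.Injective (toL2 (Γ := Γ)) := by
  rw [injective_iff_map_eq_zero]
  intro y hy
  have hval : ∀ e, valC e y = 0 := by
    intro e
    apply inclL2_injective (Γ.len_pos e)
    rw [map_zero, ← toL2_apply, hy]
    rfl
  have hder : ∀ e, derivC e y = 0 := by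
    intro e
    ext x
    have h1 := edgeDeriv_ofData y e x.2
    rw [IccExtend_of_mem _ _ x.2] at h1
    rw [← h1, edgeDeriv, onEdge_ofData, hval e]
    exact congrFun (derivWithin_const _ _) _
  have hc : y.1 = 0 := by
    funext b
    obtain ⟨e, _ | _⟩ := b
    · have h1 := congrArg (fun h : SegC (Γ.len e) => h ⟨0, (endpts_mem e).1⟩) (hval e)
      simpa [valC_apply, affinePrimitive_apply] using h1
    · have h1 := congrArg (fun h : SegC (Γ.len e) => h ⟨0, (endpts_mem e).1⟩) (hder e)
      simpa [derivC_apply, affinePrimitive_apply] using h1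
  have hg : y.2 = 0 := by
    ext1 e
    apply primitive_injective (Γ.len_pos e).le
    have h1 := hder e
    rw [derivC_apply, affinePrimitive, hc] at h1
    simpa using h1
  exact Prod.ext hc hg

variable {W : E → ℝ → ℂ} (hW : ∀ e, MemLp (W e) 2 (volume.restrict (Ioc 0 (Γ.len e))))

/-- Multiplication by the potential. -/
noncomputable def potL2 : Γ.H2Data →L[ℂ] Γ.L2 :=
  ((PiLp.continuousLinearEquiv 2 ℂ fun e => SegL2 (Γ.len e)).symm :
      ((e : E) → SegL2 (Γ.len e)) →L[ℂ] Γ.L2).comp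
    (ContinuousLinearMap.pi fun e => (mulL2 (Γ.len_pos e).le (W e) (hW e)).comp (valC e))

theorem potL2_apply (y : Γ.H2Data) (e : E) :
    potL2 hW y e = mulL2 (Γ.len_pos e).le (W e) (hW e) (valC e y) := rfl

variable [Fintype E]

theorem isCompactOperator_pi_L2 {M : Type*} [AddCommGroup M] [Module ℂ M] [TopologicalSpace M]
    (G : ∀ e, M →L[ℂ] SegL2 (Γ.len e)) (hG : ∀ e, IsCompactOperator (G e)) :
    IsCompactOperator (((PiLp.continuousLinearEquiv 2 ℂ fun e => SegL2 (Γ.len e)).symm :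
      ((e : E) → SegL2 (Γ.len e)) →L[ℂ] Γ.L2).comp (ContinuousLinearMap.pi G)) := by
  classical
  have h : IsCompactOperator (ContinuousLinearMap.pi G) := by
    have h1 : (ContinuousLinearMap.pi G : M → ∀ e, SegL2 (Γ.len e))
        = ∑ e, ((ContinuousLinearMap.single ℂ (fun e => SegL2 (Γ.len e)) e).comp (G e) :
          M →L[ℂ] ∀ e, SegL2 (Γ.len e)) := by
      funext x
      ext1 e
      simp [ContinuousLinearMap.single]
    rw [h1]
    exact Submodule.sum_mem (compactOperator (RingHom.id ℂ) M (∀ e, SegL2 (Γ.len e))) fun e _ =>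
      (hG e).clm_comp (ContinuousLinearMap.single ℂ (fun e => SegL2 (Γ.len e)) e)
  exact h.clm_comp ((PiLp.continuousLinearEquiv 2 ℂ fun e => SegL2 (Γ.len e)).symm :
      ((e : E) → SegL2 (Γ.len e)) →L[ℂ] Γ.L2)

theorem isCompactOperator_toL2 : IsCompactOperator (toL2 (Γ := Γ)) :=
  isCompactOperator_pi_L2 _ fun e => (isCompactOperator_valC e).clm_comp (inclL2 (Γ.len_pos e).le)

theorem isCompactOperator_potL2 : IsCompactOperator (potL2 hW) :=
  isCompactOperator_pi_L2 _ fun e =>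
    (isCompactOperator_valC e).clm_comp (mulL2 (Γ.len_pos e).le (W e) (hW e))

/-- The differential expression `-f'' + W f + κ f`. -/
noncomputable def hamL2 (κ : ℝ) : Γ.H2Data →L[ℂ] Γ.L2 :=
  -(ContinuousLinearMap.snd ℂ _ _) + potL2 hW + (κ : ℂ) • toL2

theorem hamL2_apply (κ : ℝ) (y : Γ.H2Data) :
    hamL2 hW κ y = -y.2 + potL2 hW y + (κ : ℂ) • toL2 y := rfl

end MetricGraph

namespace MetricGraph

open scoped ComplexConjugate BoundedContinuousFunction

variable {V E : Type*} [Fintype E] {Γ : MetricGraph V E}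

theorem sum_ends_eq_sum_edges (φ : E × Bool → ℂ) :
    ∑ b, φ b = ∑ e, (φ (e, true) + φ (e, false)) := by
  rw [Fintype.sum_prod_type]
  simp

theorem inner_toL2_snd (y z : Γ.H2Data) :
    inner ℂ (toL2 z) y.2 = -(∑ e, inner ℂ (inclL2 (Γ.len_pos e).le (derivC e z))
        (inclL2 (Γ.len_pos e).le (derivC e y)))
      - ∑ b, endDerivL y b * conj (endValL z b) := by
  rw [PiLp.inner_apply, sum_ends_eq_sum_edges, ← Finset.sum_neg_distrib, ← Finset.sum_sub_distrib]
  refine Finset.sum_congr rfl fun e _ => ?_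
  have h := inner_inclL2_affinePrimitive (Γ.len_pos e).le (z.1 (e, false)) (y.1 (e, true))
    (inclL2 (Γ.len_pos e).le (derivC e z)) (y.2 e)
  rw [← valC_apply, ← derivC_apply] at h
  have h1 : endDerivL y (e, true) = -derivC e y ⟨Γ.len e, (endpts_mem e).2⟩ := by
    rw [endDerivL_apply]
    simp [endPoint]
  have h2 : endDerivL y (e, false) = derivC e y ⟨0, (endpts_mem e).1⟩ := by
    rw [endDerivL_apply]
    simp [endPoint]
  have h3 : endValL z (e, true) = valC e z ⟨Γ.len e, (endpts_mem e).2⟩ := rfl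
  have h4 : endValL z (e, false) = valC e z ⟨0, (endpts_mem e).1⟩ := rfl
  have h5 : inner ℂ (toL2 z e) (y.2 e) = inner ℂ (inclL2 (Γ.len_pos e).le (valC e z)) (y.2 e) := rfl
  rw [h1, h2, h3, h4, h5, h]
  ring

variable {W : E → ℝ → ℂ} (hW : ∀ e, MemLp (W e) 2 (volume.restrict (Ioc 0 (Γ.len e))))

theorem inner_toL2_hamL2 (κ : ℝ) (y z : Γ.H2Data) :
    inner ℂ (toL2 z) (hamL2 hW κ y) = ∑ e, inner ℂ (inclL2 (Γ.len_pos e).le (derivC e z))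
        (inclL2 (Γ.len_pos e).le (derivC e y))
      + inner ℂ (toL2 z) (potL2 hW y) + κ * inner ℂ (toL2 z) (toL2 y)
      + ∑ b, endDerivL y b * conj (endValL z b) := by
  rw [hamL2_apply, inner_add_right, inner_add_right, inner_neg_right, inner_smul_right,
    inner_toL2_snd]
  ring

theorem inner_toL2_potL2 (hreal : ∀ e x, conj (W e x) = W e x) (y z : Γ.H2Data) :
    inner ℂ (toL2 z) (potL2 hW y) = inner ℂ (potL2 hW z) (toL2 y) := by
  rw [PiLp.inner_apply, PiLp.inner_apply]
  refine Finset.sum_congr rfl fun e _ => ?_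
  rw [L2.inner_def, L2.inner_def]
  refine integral_congr_ae ?_
  filter_upwards [coeFn_inclL2 (Γ.len_pos e).le (valC e z),
    coeFn_inclL2 (Γ.len_pos e).le (valC e y),
    coeFn_mulL2 (Γ.len_pos e).le (W e) (hW e) (valC e z),
    coeFn_mulL2 (Γ.len_pos e).le (W e) (hW e) (valC e y)] with x h1 h2 h3 h4
  change inner ℂ (inclL2 (Γ.len_pos e).le (valC e z) x)
    (mulL2 (Γ.len_pos e).le (W e) (hW e) (valC e y) x)
    = inner ℂ (mulL2 (Γ.len_pos e).le (W e) (hW e) (valC e z) x)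
    (inclL2 (Γ.len_pos e).le (valC e y) x)
  rw [h1, h2, h3, h4, RCLike.inner_apply, RCLike.inner_apply, map_mul, hreal]
  ring

/-- Green's formula. -/
theorem inner_toL2_hamL2_sub (hreal : ∀ e x, conj (W e x) = W e x) (κ : ℝ) (y z : Γ.H2Data) :
    inner ℂ (toL2 z) (hamL2 hW κ y) - inner ℂ (hamL2 hW κ z) (toL2 y)
      = ∑ b, endDerivL y b * conj (endValL z b) - ∑ b, endValL y b * conj (endDerivL z b) := by
  have h1 := inner_toL2_hamL2 hW κ y z
  have h2 := congrArg conj (inner_toL2_hamL2 hW κ z y)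
  simp only [inner_conj_symm, map_add, map_sum, map_mul, Complex.conj_ofReal,
    Complex.conj_conj] at h2
  rw [h1, h2, inner_toL2_potL2 hW hreal]
  have h3 : ∑ b, endValL y b * conj (endDerivL z b)
      = ∑ b, conj (endDerivL z b) * endValL y b :=
    Finset.sum_congr rfl fun b _ => mul_comm _ _
  rw [h3]
  ring

/-- For large `κ` the form of `-d²/dx² + W + κ` without its boundary terms dominates the boundary
values. -/
theorem exists_forall_endVal_le_form {C : ℝ} (hC : 0 ≤ C) : ∃ κ : ℝ, ∀ y : Γ.H2Data,
    (∑ b, endDerivL y b * conj (endValL y b)).re + C * ∑ b, ‖endValL y b‖ ^ 2 + ‖toL2 y‖ ^ 2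
      ≤ (inner ℂ (toL2 y) (hamL2 hW κ y)).re := by
  choose κ₀ hκ₀ using fun e => exists_forall_boundary_le_form (Γ.len_pos e).le (Γ.len_pos e)
    (W e) (hW e) hC
  refine ⟨∑ e, |κ₀ e|, fun y => ?_⟩
  have hedge : ∀ e, C * (‖endValL y (e, true)‖ ^ 2 + ‖endValL y (e, false)‖ ^ 2)
      + ‖toL2 y e‖ ^ 2 ≤ ‖inclL2 (Γ.len_pos e).le (derivC e y)‖ ^ 2
        + (inner ℂ (toL2 y e) (potL2 hW y e)).re + (∑ e, |κ₀ e|) * ‖toL2 y e‖ ^ 2 := by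
    intro e
    have h1 : κ₀ e ≤ ∑ e, |κ₀ e| := (le_abs_self _).trans
      (Finset.single_le_sum (f := fun e => |κ₀ e|) (fun _ _ => abs_nonneg _) (Finset.mem_univ e))
    have h2 := hκ₀ e _ h1 (y.1 (e, false)) (inclL2 (Γ.len_pos e).le (derivC e y))
    rw [← valC_apply, add_comm (‖valC e y _‖ ^ 2)] at h2
    exact h2
  have hsum := Finset.sum_le_sum fun e (_ : e ∈ Finset.univ) => hedge e
  simp only [Finset.sum_add_distrib, ← Finset.mul_sum] at hsum
  have hnorm : ‖toL2 y‖ ^ 2 = ∑ e, ‖toL2 y e‖ ^ 2 := PiLp.norm_sq_eq_of_L2 _ _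
  have hval : ∑ b, ‖endValL y b‖ ^ 2
      = ∑ e, ‖endValL y (e, true)‖ ^ 2 + ∑ e, ‖endValL y (e, false)‖ ^ 2 := by
    rw [Fintype.sum_prod_type, ← Finset.sum_add_distrib]
    simp
  have hself : ∀ {G : Type _} [NormedAddCommGroup G] [InnerProductSpace ℂ G] (x : G),
      (inner ℂ x x).re = ‖x‖ ^ 2 := fun x => inner_self_eq_norm_sq (𝕜 := ℂ) x
  rw [inner_toL2_hamL2, Complex.add_re, Complex.add_re, Complex.add_re,
    Complex.re_ofReal_mul, hself, PiLp.inner_apply (toL2 y), hval, hnorm]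
  simp only [Complex.re_sum]
  have hder : ∑ e, (inner ℂ (inclL2 (Γ.len_pos e).le (derivC e y))
      (inclL2 (Γ.len_pos e).le (derivC e y))).re
      = ∑ e, ‖inclL2 (Γ.len_pos e).le (derivC e y)‖ ^ 2 :=
    Finset.sum_congr rfl fun e _ => inner_self_eq_norm_sq (𝕜 := ℂ) _
  rw [hder]
  linarith

end MetricGraph

namespace MetricGraph

open scoped ComplexConjugate BoundedContinuousFunction

variable {V E : Type*} {Γ : MetricGraph V E}

/-- The common value at `v` of a function that is continuous there. -/
noncomputable def valueAt (v : V) (F : Γ.Star v → ℂ) : ℂ :=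
  open Classical in if h : Nonempty (Γ.Star v) then F h.some else 0

theorem valueAt_eq {v : V} {F : Γ.Star v → ℂ} (h : ∀ b b', F b = F b') (b : Γ.Star v) :
    valueAt v F = F b := by
  have hne : Nonempty (Γ.Star v) := ⟨b⟩
  rw [valueAt, dif_pos hne]
  exact h _ _

/-- The value at `v`. -/
noncomputable def vval (v : V) (y : Γ.H2Data) : ℂ := valueAt v fun b : Γ.Star v => endValL y b.1

theorem vval_eq_zero_of_isEmpty {v : V} (h : IsEmpty (Γ.Star v)) (y : Γ.H2Data) : vval v y = 0 := by
  rw [vval, valueAt, dif_neg (not_nonempty_iff.2 h)]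

theorem vertexVal_ofData (y : Γ.H2Data) (u : V) :
    vertexVal (ofData y) u = fun b : Γ.Star u => endValL y b.1 :=
  funext fun b => endVal_ofData y b.1

theorem vertexDeriv_ofData (y : Γ.H2Data) (u : V) :
    vertexDeriv (ofData y) u = fun b : Γ.Star u => endDerivL y b.1 :=
  funext fun b => endDeriv_ofData y b.1

/-- The relation between value and sum of derivatives at `v` in the `δ`-type condition. -/
def DeltaRel (α : WithTop ℝ) (s t : ℂ) : Prop :=
  match α with
  | none => t = 0
  | some a => s = (a : ℂ) * t

variable [Fintype E] [DecidableEq V]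

theorem sum_ends_eq_sum_star {M : Type*} [AddCommMonoid M] [Fintype V] (v : V) (φ : E × Bool → M) :
    ∑ b, φ b = ∑ b : Γ.Star v, φ b.1 + ∑ u ∈ Finset.univ.erase v, ∑ b : Γ.Star u, φ b.1 := by
  rw [Finset.add_sum_erase Finset.univ (fun u => ∑ b : Γ.Star u, φ b.1) (Finset.mem_univ v),
    ← Fintype.sum_sigma' (fun u (b : Γ.Star u) => φ b.1)]
  exact (Equiv.sum_comp (Equiv.sigmaFiberEquiv fun b : E × Bool => Γ.endpt b.1 b.2) φ).symm

/-- `f` is continuous at `v` and satisfies the given conditions at all other vertices. -/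
def PartialConditions (v : V) (bc : ∀ u : V, u ≠ v → SelfAdjointCondition (Γ.Star u))
    (y : Γ.H2Data) : Prop :=
  (∀ b b' : Γ.Star v, endValL y b.1 = endValL y b'.1) ∧
  ∀ (u : V) (hu : u ≠ v), (bc u hu).A.mulVec (fun b : Γ.Star u => endValL y b.1)
    + (bc u hu).B.mulVec (fun b : Γ.Star u => endDerivL y b.1) = 0

/-- The sum of the derivatives at `v`. -/
noncomputable def vder (v : V) (y : Γ.H2Data) : ℂ := ∑ b : Γ.Star v, endDerivL y b.1

theorem vder_eq_zero_of_isEmpty {v : V} (h : IsEmpty (Γ.Star v)) (y : Γ.H2Data) : vder v y = 0 := by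
  rw [vder, Finset.univ_eq_empty, Finset.sum_empty]

theorem vertexConditions_ofData_iff {v : V}
    {bc : ∀ u : V, u ≠ v → SelfAdjointCondition (Γ.Star u)} {α : WithTop ℝ} {y : Γ.H2Data} :
    VertexConditions v bc α (ofData y) ↔
      PartialConditions v bc y ∧ DeltaRel α (vder v y) (vval v y) := by
  unfold VertexConditions DeltaCondition PartialConditions
  simp only [vertexVal_ofData, vertexDeriv_ofData]
  rw [and_right_comm]
  refine and_congr_right fun h => ?_
  rcases isEmpty_or_nonempty (Γ.Star v) with hE | ⟨⟨b₀⟩⟩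
  · have h1 := vval_eq_zero_of_isEmpty hE y
    have h2 := vder_eq_zero_of_isEmpty hE y
    rcases α with _ | a
    · exact ⟨fun _ => h1, fun _ b => (hE.false b).elim⟩
    · refine ⟨fun _ => ?_, fun _ b => (hE.false b).elim⟩
      rw [h1, h2]
      exact (mul_zero _).symm
  · have hval : ∀ b : Γ.Star v, vval v y = endValL y b.1 := fun b => valueAt_eq h.1 b
    rcases α with _ | a
    · exact ⟨fun h0 => (hval b₀).trans (h0 b₀), fun h0 b => (hval b).symm.trans h0⟩
    · refine ⟨fun h0 => ?_, fun h0 b => ?_⟩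
      · rw [hval b₀]
        exact h0 b₀
      · rw [← hval b]
        exact h0

theorem sum_star_eq {v : V} {bc : ∀ u : V, u ≠ v → SelfAdjointCondition (Γ.Star u)}
    {z : Γ.H2Data} (hz : PartialConditions v bc z) (φ : Γ.Star v → ℂ) :
    ∑ b : Γ.Star v, φ b * conj (endValL z b.1) = (∑ b, φ b) * conj (vval v z) := by
  rw [Finset.sum_mul]
  refine Finset.sum_congr rfl fun b _ => ?_
  rw [vval, valueAt_eq hz.1 b]

theorem boundary_form_eq [Finite V] {v : V}
    {bc : ∀ u : V, u ≠ v → SelfAdjointCondition (Γ.Star u)} {y z : Γ.H2Data}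
    (hy : PartialConditions v bc y) (hz : PartialConditions v bc z) :
    ∑ b, endDerivL y b * conj (endValL z b) - ∑ b, endValL y b * conj (endDerivL z b)
      = vder v y * conj (vval v z) - vval v y * conj (vder v z) := by
  have := Fintype.ofFinite V
  rw [sum_ends_eq_sum_star (Γ := Γ) v, sum_ends_eq_sum_star (Γ := Γ) v, sum_star_eq hz]
  have h1 : ∑ b : Γ.Star v, endValL y b.1 * conj (endDerivL z b.1)
      = vval v y * conj (vder v z) := by
    have h := congrArg conj (sum_star_eq hy fun b => endDerivL z b.1)
    simp only [map_sum, map_mul, Complex.conj_conj] at h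
    rw [vder, map_sum, mul_comm, ← h]
    exact Finset.sum_congr rfl fun b _ => mul_comm _ _
  have h2 : ∑ u ∈ Finset.univ.erase v, ∑ b : Γ.Star u, endDerivL y b.1 * conj (endValL z b.1)
      = ∑ u ∈ Finset.univ.erase v, ∑ b : Γ.Star u, endValL y b.1 * conj (endDerivL z b.1) := by
    refine Finset.sum_congr rfl fun u hu => ?_
    have hu' := Finset.ne_of_mem_erase hu
    exact (bc u hu').sum_mul_conj_eq (hy.2 u hu') (hz.2 u hu')
  rw [h1, h2]
  change vder v y * _ + _ - _ = _
  ring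

theorem DeltaRel.mul_conj_eq {α : WithTop ℝ} {s t s' t' : ℂ} (h : DeltaRel α s t)
    (h' : DeltaRel α s' t') : s * conj t' - t * conj s' = 0 := by
  rcases α with _ | a
  · have h1 : t = 0 := h
    have h2 : t' = 0 := h'
    simp [h1, h2]
  · have h1 : s = a * t := h
    have h2 : s' = a * t' := h'
    rw [h1, h2, map_mul, Complex.conj_ofReal]
    ring

theorem exists_deltaMap (ι : Type*) [Fintype ι] (α : WithTop ℝ) :
    ∃ N : ((ι → ℂ) × (ι → ℂ)) →ₗ[ℂ] (ι → ℂ), ∀ F F' : ι → ℂ, N (F, F') = 0 ↔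
      (∀ b b', F b = F b') ∧ ∀ b, DeltaRel α (∑ b', F' b') (F b) := by
  classical
  rcases isEmpty_or_nonempty ι with hE | ⟨⟨b₀⟩⟩
  · exact ⟨0, fun F F' => ⟨fun _ => ⟨fun b => (hE.false b).elim, fun b => (hE.false b).elim⟩,
      fun _ => rfl⟩⟩
  let ev : ι → ((ι → ℂ) × (ι → ℂ)) →ₗ[ℂ] ℂ := fun b =>
    (LinearMap.proj b).comp (LinearMap.fst ℂ _ _)
  let sm : ((ι → ℂ) × (ι → ℂ)) →ₗ[ℂ] ℂ :=
    ∑ b, (LinearMap.proj b).comp (LinearMap.snd ℂ (ι → ℂ) (ι → ℂ))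
  have hsm : ∀ F F' : ι → ℂ, sm (F, F') = ∑ b, F' b := fun F F' => by simp [sm]
  obtain ⟨r, hr⟩ : ∃ r : ((ι → ℂ) × (ι → ℂ)) →ₗ[ℂ] ℂ, ∀ F F' : ι → ℂ,
      r (F, F') = 0 ↔ DeltaRel α (∑ b', F' b') (F b₀) := by
    rcases α with _ | a
    · exact ⟨ev b₀, fun F F' => Iff.rfl⟩
    · refine ⟨sm - (a : ℂ) • ev b₀, fun F F' => ?_⟩
      rw [LinearMap.sub_apply, hsm, sub_eq_zero]
      exact Iff.rfl
  refine ⟨LinearMap.pi fun b => if b = b₀ then r else ev b - ev b₀, fun F F' => ?_⟩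
  constructor
  · intro h
    have h1 : ∀ b, F b = F b₀ := by
      intro b
      by_cases hb : b = b₀
      · rw [hb]
      · have h2 := congrFun h b
        rw [LinearMap.pi_apply, if_neg hb] at h2
        exact sub_eq_zero.1 h2
    refine ⟨fun b b' => (h1 b).trans (h1 b').symm, fun b => ?_⟩
    have h2 := congrFun h b₀
    rw [LinearMap.pi_apply, if_pos rfl] at h2
    rw [h1 b]
    exact (hr F F').1 h2
  · rintro ⟨h1, h2⟩
    funext b
    rw [LinearMap.pi_apply]
    by_cases hb : b = b₀
    · rw [if_pos hb]
      exact (hr F F').2 (h2 b₀)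
    · rw [if_neg hb]
      exact sub_eq_zero.2 (h1 b b₀)

theorem exists_boundaryMap (v : V) (bc : ∀ u : V, u ≠ v → SelfAdjointCondition (Γ.Star u))
    (α : WithTop ℝ) : ∃ N : ((E × Bool → ℂ) × (E × Bool → ℂ)) →ₗ[ℂ] (E × Bool → ℂ),
      ∀ y : Γ.H2Data, N (endValL y, endDerivL y) = 0 ↔ VertexConditions v bc α (ofData y) := by
  have hloc : ∀ u : V, ∃ N : ((Γ.Star u → ℂ) × (Γ.Star u → ℂ)) →ₗ[ℂ] (Γ.Star u → ℂ),
      ∀ F F' : Γ.Star u → ℂ, N (F, F') = 0 ↔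
        (u = v → (∀ b b', F b = F b') ∧ ∀ b, DeltaRel α (∑ b', F' b') (F b)) ∧
        ∀ hu : u ≠ v, (bc u hu).A.mulVec F + (bc u hu).B.mulVec F' = 0 := by
    intro u
    by_cases hu : u = v
    · obtain ⟨N, hN⟩ := exists_deltaMap (Γ.Star u) α
      refine ⟨N, fun F F' => (hN F F').trans ⟨fun h => ⟨fun _ => h, fun h' => (h' hu).elim⟩,
        fun h => h.1 hu⟩⟩
    · refine ⟨(bc u hu).A.mulVecLin.coprod (bc u hu).B.mulVecLin, fun F F' => ?_⟩
      exact ⟨fun h => ⟨fun h' => (hu h').elim, fun _ => h⟩, fun h => h.2 hu⟩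
  choose N hN using hloc
  let res : ∀ u : V, (E × Bool → ℂ) →ₗ[ℂ] (Γ.Star u → ℂ) := fun u =>
    LinearMap.funLeft ℂ ℂ Subtype.val
  refine ⟨LinearMap.pi fun b => (LinearMap.proj (⟨b, rfl⟩ : Γ.Star (Γ.endpt b.1 b.2))).comp
    ((N (Γ.endpt b.1 b.2)).comp ((res _).prodMap (res _))), fun y => ?_⟩
  have h1 : (∀ u, N u (fun b : Γ.Star u => endValL y b.1, fun b : Γ.Star u => endDerivL y b.1) = 0)
      ↔ VertexConditions v bc α (ofData y) := by
    simp only [hN, VertexConditions, DeltaCondition, vertexVal_ofData, vertexDeriv_ofData]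
    constructor
    · intro h
      refine ⟨⟨((h v).1 rfl).1, ?_⟩, fun u hu => (h u).2 hu⟩
      have h2 := ((h v).1 rfl).2
      rcases α with _ | a <;> exact h2
    · rintro ⟨⟨h2, h3⟩, h4⟩ u
      refine ⟨?_, h4 u⟩
      rintro rfl
      refine ⟨h2, ?_⟩
      rcases α with _ | a <;> exact h3
  rw [← h1]
  constructor
  · intro h u
    funext ⟨b, hb⟩
    subst hb
    exact congrFun h b
  · intro h
    funext b
    exact congrFun (h (Γ.endpt b.1 b.2)) ⟨b, rfl⟩

variable {W : E → ℝ → ℂ} (hW : ∀ e, MemLp (W e) 2 (volume.restrict (Ioc 0 (Γ.len e))))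

theorem exists_forall_vertex_le_form [Finite V] (v : V)
    (bc : ∀ u : V, u ≠ v → SelfAdjointCondition (Γ.Star u)) (C : ℝ) :
    ∃ κ : ℝ, ∀ y : Γ.H2Data, PartialConditions v bc y →
      (vder v y * conj (vval v y)).re + C * ‖vval v y‖ ^ 2 + ‖toL2 y‖ ^ 2
        ≤ (inner ℂ (toL2 y) (hamL2 hW κ y)).re := by
  have := Fintype.ofFinite V
  choose c hc0 hc using fun (u : V) (hu : u ≠ v) => (bc u hu).exists_abs_re_sum_le
  let c' : V → ℝ := fun u => if hu : u ≠ v then c u hu else 0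
  have hc'0 : ∀ u, 0 ≤ c' u := fun u => by
    by_cases hu : u ≠ v
    · simp only [c', dif_pos hu, hc0]
    · simp only [c', dif_neg hu, le_refl]
  have hsum0 : 0 ≤ ∑ u, c' u := Finset.sum_nonneg fun u _ => hc'0 u
  obtain ⟨κ, hκ⟩ := exists_forall_endVal_le_form hW (C := |C| + ∑ u, c' u) (by positivity)
  refine ⟨κ, fun y hy => le_trans ?_ (hκ y)⟩
  gcongr ?_ + _
  rw [sum_ends_eq_sum_star (Γ := Γ) v, sum_ends_eq_sum_star (Γ := Γ) v, sum_star_eq hy,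
    Complex.add_re, Complex.re_sum]
  have h1 : C * ‖vval v y‖ ^ 2
      ≤ (|C| + ∑ u, c' u) * ∑ b : Γ.Star v, ‖endValL y b.1‖ ^ 2 := by
    rcases isEmpty_or_nonempty (Γ.Star v) with hE | ⟨⟨b₀⟩⟩
    · rw [vval_eq_zero_of_isEmpty hE]
      simp
    · have h2 : ‖vval v y‖ ^ 2 ≤ ∑ b : Γ.Star v, ‖endValL y b.1‖ ^ 2 := by
        rw [vval, valueAt_eq hy.1 b₀]
        exact Finset.single_le_sum (f := fun b : Γ.Star v => ‖endValL y b.1‖ ^ 2)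
          (fun _ _ => sq_nonneg _) (Finset.mem_univ b₀)
      have h3 : C ≤ |C| + ∑ u, c' u := (le_abs_self C).trans (le_add_of_nonneg_right hsum0)
      exact (mul_le_mul_of_nonneg_right h3 (sq_nonneg _)).trans
        (mul_le_mul_of_nonneg_left h2 (by positivity))
  have h4 : 0 ≤ ∑ u ∈ Finset.univ.erase v,
      (∑ b : Γ.Star u, endDerivL y b.1 * conj (endValL y b.1)).re
      + (|C| + ∑ u, c' u) * ∑ u ∈ Finset.univ.erase v, ∑ b : Γ.Star u, ‖endValL y b.1‖ ^ 2 := by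
    rw [Finset.mul_sum, ← Finset.sum_add_distrib]
    refine Finset.sum_nonneg fun u hu => ?_
    have hu' := Finset.ne_of_mem_erase hu
    have h5 := (abs_le.1 (hc u hu' _ _ (hy.2 u hu'))).1
    have h6 : c u hu' ≤ |C| + ∑ u, c' u := by
      have h7 := Finset.single_le_sum (f := c') (fun u _ => hc'0 u) (Finset.mem_univ u)
      simp only [c', dif_pos hu'] at h7
      have := abs_nonneg C
      linarith
    have h8 : 0 ≤ ∑ b : Γ.Star u, ‖endValL y b.1‖ ^ 2 := by positivity
    have h9 := mul_le_mul_of_nonneg_right h6 h8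
    linarith
  rw [mul_add]
  have h10 : (∑ b : Γ.Star v, endDerivL y b.1) = vder v y := rfl
  rw [h10]
  linarith

end MetricGraph

namespace MetricGraph

open scoped ComplexConjugate BoundedContinuousFunction

variable {V E : Type*} {Γ : MetricGraph V E}

theorem ofData_injective : Function.Injective (ofData (Γ := Γ)) := by
  intro y z h
  apply toL2_injective
  ext1 e
  rw [toL2_apply, toL2_apply]
  congr 1
  ext x
  exact congrFun (congrFun h e) x

theorem exists_vval_linear (v : V) : ∃ ℓ : Γ.H2Data →ₗ[ℂ] ℂ, ∀ y, ℓ y = vval v y := by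
  rcases isEmpty_or_nonempty (Γ.Star v) with hE | hne
  · exact ⟨0, fun y => (vval_eq_zero_of_isEmpty hE y).symm⟩
  · refine ⟨(LinearMap.proj (R := ℂ) (φ := fun _ : E × Bool => ℂ) hne.some.1).comp
      (endValL (Γ := Γ) : Γ.H2Data →ₗ[ℂ] (E × Bool → ℂ)), fun y => ?_⟩
    rw [vval, valueAt, dif_pos hne]
    rfl

theorem vval_sub (v : V) (y z : Γ.H2Data) : vval v (y - z) = vval v y - vval v z := by
  obtain ⟨ℓ, hℓ⟩ := exists_vval_linear (Γ := Γ) v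
  rw [← hℓ, ← hℓ, ← hℓ, map_sub]

theorem vval_smul (v : V) (c : ℂ) (y : Γ.H2Data) : vval v (c • y) = c * vval v y := by
  obtain ⟨ℓ, hℓ⟩ := exists_vval_linear (Γ := Γ) v
  rw [← hℓ, ← hℓ, map_smul, smul_eq_mul]

variable [Fintype E] [DecidableEq V]

theorem vder_sub (v : V) (y z : Γ.H2Data) : vder v (y - z) = vder v y - vder v z := by
  simp [vder, map_sub]

theorem vder_smul (v : V) (c : ℂ) (y : Γ.H2Data) : vder v (c • y) = c * vder v y := by
  simp [vder, map_smul, Finset.mul_sum]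

theorem PartialConditions.sub {v : V} {bc : ∀ u : V, u ≠ v → SelfAdjointCondition (Γ.Star u)}
    {y z : Γ.H2Data} (hy : PartialConditions v bc y) (hz : PartialConditions v bc z) :
    PartialConditions v bc (y - z) := by
  refine ⟨fun b b' => ?_, fun u hu => ?_⟩
  · rw [map_sub, Pi.sub_apply, Pi.sub_apply, hy.1 b b', hz.1 b b']
  · have h1 : (fun b : Γ.Star u => endValL (y - z) b.1)
        = (fun b : Γ.Star u => endValL y b.1) - fun b : Γ.Star u => endValL z b.1 := by
      funext b
      simp
    have h2 : (fun b : Γ.Star u => endDerivL (y - z) b.1)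
        = (fun b : Γ.Star u => endDerivL y b.1) - fun b : Γ.Star u => endDerivL z b.1 := by
      funext b
      simp
    rw [h1, h2, Matrix.mulVec_sub, Matrix.mulVec_sub, sub_add_sub_comm, hy.2 u hu, hz.2 u hu,
      sub_zero]

theorem DeltaRel.exists_form_bound (α : WithTop ℝ) :
    ∃ C : ℝ, 0 ≤ C ∧ ∀ s t, DeltaRel α s t → 0 ≤ (s * conj t).re + C * ‖t‖ ^ 2 := by
  rcases α with _ | a
  · refine ⟨0, le_rfl, fun s t h => ?_⟩
    have h1 : t = 0 := h
    simp [h1]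
  · refine ⟨|a|, abs_nonneg a, fun s t h => ?_⟩
    have h1 : s = a * t := h
    have h2 : (s * conj t).re = a * ‖t‖ ^ 2 := by
      rw [h1, mul_assoc, Complex.mul_conj, Complex.re_ofReal_mul, Complex.ofReal_re,
        Complex.normSq_eq_norm_sq]
    rw [h2, ← add_mul]
    exact mul_nonneg (by linarith [neg_abs_le a]) (sq_nonneg _)

/-- `S` maps `g ∈ L²(Γ)` to the data of `(H + κ)⁻¹ g`, where `H` is the Hamiltonian of `Γ_α`. -/
structure IsResolvent {W : E → ℝ → ℂ}
    (hW : ∀ e, MemLp (W e) 2 (volume.restrict (Ioc 0 (Γ.len e)))) (κ : ℝ) (v : V)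
    (bc : ∀ u : V, u ≠ v → SelfAdjointCondition (Γ.Star u)) (α : WithTop ℝ)
    (S : Γ.L2 →L[ℂ] Γ.H2Data) : Prop where
  cond : ∀ g, VertexConditions v bc α (ofData (S g))
  ham_apply : ∀ g, hamL2 hW κ (S g) = g
  apply_ham : ∀ y, VertexConditions v bc α (ofData y) → S (hamL2 hW κ y) = y

variable {W : E → ℝ → ℂ} {hW : ∀ e, MemLp (W e) 2 (volume.restrict (Ioc 0 (Γ.len e)))} {κ : ℝ}
  {v : V} {bc : ∀ u : V, u ≠ v → SelfAdjointCondition (Γ.Star u)} {α : WithTop ℝ}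

theorem exists_isResolvent (hform : ∀ y : Γ.H2Data, VertexConditions v bc α (ofData y) →
    ‖toL2 y‖ ^ 2 ≤ (inner ℂ (toL2 y) (hamL2 hW κ y)).re) : ∃ S, IsResolvent hW κ v bc α S := by
  obtain ⟨N, hN⟩ := exists_boundaryMap v bc α
  let Nc : ((E × Bool → ℂ) × (E × Bool → ℂ)) →L[ℂ] (E × Bool → ℂ) :=
    LinearMap.toContinuousLinearMap N
  let K₁ : Γ.H2Data →L[ℂ] (E × Bool → ℂ) :=
    ContinuousLinearMap.fst ℂ _ _ + Nc.comp (endValL.prod endDerivL)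
  let K₂ : Γ.H2Data →L[ℂ] Γ.L2 := potL2 hW + (κ : ℂ) • toL2
  let K : Γ.H2Data →L[ℂ] Γ.H2Data :=
    (ContinuousLinearMap.inl ℂ _ _).comp K₁ + (ContinuousLinearMap.inr ℂ _ _).comp K₂
  have hK : IsCompactOperator K := by
    have h1 : IsCompactOperator K₁ := isCompactOperator_of_locallyCompactSpace_dom K₁
    have h2 : IsCompactOperator K₂ :=
      (isCompactOperator_potL2 hW).add (isCompactOperator_toL2.smul (κ : ℂ))
    exact (h1.clm_comp (ContinuousLinearMap.inl ℂ (E × Bool → ℂ) Γ.L2)).add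
      (h2.clm_comp (ContinuousLinearMap.inr ℂ (E × Bool → ℂ) Γ.L2))
  have hKy : ∀ y, y - K y = (-N (endValL y, endDerivL y), -hamL2 hW κ y) := by
    intro y
    refine Prod.ext ?_ ?_
    · change y.1 - (y.1 + N (endValL y, endDerivL y) + 0) = -N (endValL y, endDerivL y)
      abel
    · change y.2 - (0 + (potL2 hW y + (κ : ℂ) • toL2 y)) = -(-y.2 + potL2 hW y + (κ : ℂ) • toL2 y)
      abel
  have hker : ¬ Module.End.HasEigenvalue (K : Module.End ℂ Γ.H2Data) 1 := by
    intro hev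
    obtain ⟨y, hy, hy0⟩ := hev.exists_hasEigenvector
    have h1 : K y = y := by simpa using Module.End.mem_eigenspace_iff.1 hy
    have h2 := hKy y
    rw [h1, sub_self] at h2
    have h3 : N (endValL y, endDerivL y) = 0 := neg_eq_zero.1 (congrArg Prod.fst h2).symm
    have h4 : hamL2 hW κ y = 0 := neg_eq_zero.1 (congrArg Prod.snd h2).symm
    have h5 := hform y ((hN y).1 h3)
    rw [h4, inner_zero_right, Complex.zero_re] at h5
    have h6 : toL2 y = 0 := by
      rw [← norm_eq_zero]
      exact pow_eq_zero_iff two_ne_zero |>.1 (le_antisymm h5 (sq_nonneg _))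
    exact hy0 (toL2_injective (h6.trans (map_zero toL2).symm))
  have hunit := (IsCompactOperator.hasEigenvalue_or_mem_resolventSet hK
    (one_ne_zero (α := ℂ))).resolve_left hker
  rw [spectrum.mem_resolventSet_iff, map_one] at hunit
  obtain ⟨U, hU⟩ := hunit
  let R : Γ.H2Data →L[ℂ] Γ.H2Data := ↑U⁻¹
  have hR1 : ∀ y, R y - K (R y) = y := by
    intro y
    have h := congrArg (fun A : Γ.H2Data →L[ℂ] Γ.H2Data => A y) U.mul_inv
    simp only [hU] at h
    exact h
  have hR2 : ∀ y, R (y - K y) = y := by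
    intro y
    have h := congrArg (fun A : Γ.H2Data →L[ℂ] Γ.H2Data => A y) U.inv_mul
    simp only [hU] at h
    exact h
  refine ⟨-(R.comp (ContinuousLinearMap.inr ℂ _ _)), fun g => ?_, fun g => ?_, fun y hy => ?_⟩
  · have h1 := (hKy (R (0, -g))).symm.trans (hR1 (0, -g))
    have h2 : (-(R.comp (ContinuousLinearMap.inr ℂ _ _))) g = R (0, -g) := by
      change -R (0, g) = R (0, -g)
      rw [← map_neg]
      simp
    rw [h2, ← hN]
    exact neg_eq_zero.1 (congrArg Prod.fst h1)
  · have h1 := (hKy (R (0, -g))).symm.trans (hR1 (0, -g))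
    have h2 : (-(R.comp (ContinuousLinearMap.inr ℂ _ _))) g = R (0, -g) := by
      change -R (0, g) = R (0, -g)
      rw [← map_neg]
      simp
    rw [h2]
    exact neg_injective (congrArg Prod.snd h1)
  · have h1 := hR2 y
    rw [hKy, (hN y).2 hy, neg_zero] at h1
    change -R (0, hamL2 hW κ y) = y
    rw [← map_neg]
    simpa using h1

namespace IsResolvent

variable {S : Γ.L2 →L[ℂ] Γ.H2Data}

theorem partialConditions (hS : IsResolvent hW κ v bc α S) (g : Γ.L2) : PartialConditions v bc (S g) :=
  (vertexConditions_ofData_iff.1 (hS.cond g)).1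

theorem deltaRel (hS : IsResolvent hW κ v bc α S) (g : Γ.L2) :
    DeltaRel α (vder v (S g)) (vval v (S g)) :=
  (vertexConditions_ofData_iff.1 (hS.cond g)).2

theorem isSymmetric [Finite V] (hS : IsResolvent hW κ v bc α S)
    (hreal : ∀ e x, conj (W e x) = W e x) :
    (toL2.comp S : Γ.L2 →ₗ[ℂ] Γ.L2).IsSymmetric := by
  intro g h
  have h1 := inner_toL2_hamL2_sub hW hreal κ (S h) (S g)
  rw [boundary_form_eq (hS.partialConditions h) (hS.partialConditions g),
    (hS.deltaRel h).mul_conj_eq (hS.deltaRel g), hS.ham_apply, hS.ham_apply] at h1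
  exact sub_eq_zero.1 h1

theorem inner_pos (hS : IsResolvent hW κ v bc α S)
    (hform : ∀ y : Γ.H2Data, VertexConditions v bc α (ofData y) →
    ‖toL2 y‖ ^ 2 ≤ (inner ℂ (toL2 y) (hamL2 hW κ y)).re) (g : Γ.L2) (hg : g ≠ 0) :
    0 < (inner ℂ (toL2.comp S g) g).re := by
  have h1 := hform (S g) (hS.cond g)
  rw [hS.ham_apply] at h1
  refine lt_of_lt_of_le ?_ h1
  have h2 : toL2 (S g) ≠ 0 := by
    intro h0
    apply hg
    have h3 : S g = 0 := toL2_injective (h0.trans (map_zero toL2).symm)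
    rw [← hS.ham_apply g, h3, map_zero]
  positivity

end IsResolvent

theorem mem_eigenspace_iff_exists {W : E → ℝ → ℝ}
    {hW : ∀ e, MemLp (fun x => (W e x : ℂ)) 2 (volume.restrict (Ioc 0 (Γ.len e)))}
    {μ : ℂ} {f : Γ.Fun} : f ∈ eigenspace W v bc α μ ↔ ∃ y : Γ.H2Data, ofData y = f ∧
      VertexConditions v bc α (ofData y) ∧ hamL2 hW κ y = (μ + κ) • toL2 y := by
  have key : ∀ y : Γ.H2Data, hamL2 hW κ y = (μ + κ) • toL2 y ↔
      ∀ e, ∀ᵐ x ∂volume.restrict (Ioc 0 (Γ.len e)),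
        onEdge (μ • ofData y) e x = -y.2 e x + (W e x : ℂ) * onEdge (ofData y) e x := by
    intro y
    have h1 : hamL2 hW κ y = (μ + κ) • toL2 y ↔ -y.2 + potL2 hW y = μ • toL2 y := by
      rw [hamL2_apply, add_smul, add_left_inj]
    have h2 : -y.2 + potL2 hW y = μ • toL2 y ↔
        ∀ e, -y.2 e + potL2 hW y e = μ • toL2 y e := by
      constructor
      · intro h e
        exact congrArg (fun g : Γ.L2 => g e) h
      · intro h
        ext1 e
        exact h e
    rw [h1, h2]
    refine forall_congr' fun e => ?_
    rw [Lp.ext_iff]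
    have h3 : ∀ᵐ x ∂volume.restrict (Ioc 0 (Γ.len e)),
        ((-y.2 e + potL2 hW y e : SegL2 (Γ.len e)) x = (μ • toL2 y e : SegL2 (Γ.len e)) x ↔
          onEdge (μ • ofData y) e x = -y.2 e x + (W e x : ℂ) * onEdge (ofData y) e x) := by
      filter_upwards [Lp.coeFn_add (-y.2 e) (potL2 hW y e), Lp.coeFn_neg (y.2 e),
        Lp.coeFn_smul μ (toL2 y e), coeFn_inclL2 (Γ.len_pos e).le (valC e y),
        coeFn_mulL2 (Γ.len_pos e).le (fun x => (W e x : ℂ)) (hW e) (valC e y)]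
        with x h4 h5 h6 h7 h8
      rw [h4, Pi.add_apply, h5, h6, Pi.neg_apply, Pi.smul_apply, potL2_apply, toL2_apply, h7, h8,
        onEdge_smul, Pi.smul_apply, onEdge_ofData, eq_comm]
    constructor
    · intro h
      filter_upwards [h, h3] with x h4 h5 using h5.1 h4
    · intro h
      filter_upwards [h, h3] with x h4 h5 using h5.2 h4
  constructor
  · intro hf
    have hf' : HamiltonianMaps W v bc α f (μ • f) := hf
    choose g hg hgae using hf'.2
    obtain ⟨y, rfl, hy⟩ := exists_ofData_eq hg
    refine ⟨y, rfl, hf'.1, (key y).2 fun e => ?_⟩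
    filter_upwards [hgae e, hy e] with x h1 h2
    rw [h1, h2]
  · rintro ⟨y, rfl, hy1, hy2⟩
    exact ⟨hy1, fun e => ⟨y.2 e, hasSecondDeriv_ofData y e, (key y).1 hy2 e⟩⟩

end MetricGraph

namespace MetricGraph

open scoped ComplexConjugate

variable {V E : Type*} [Fintype E] [DecidableEq V] {Γ : MetricGraph V E}
  {W : E → ℝ → ℝ} {hW : ∀ e, MemLp (fun x => (W e x : ℂ)) 2 (volume.restrict (Ioc 0 (Γ.len e)))}
  {κ : ℝ} {v : V} {bc : ∀ u : V, u ≠ v → SelfAdjointCondition (Γ.Star u)} {α : WithTop ℝ}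
  {S : Γ.L2 →L[ℂ] Γ.H2Data}

namespace IsResolvent

theorem eigenspace_zero_eq_bot (hS : IsResolvent hW κ v bc α S) :
    Module.End.eigenspace (toL2.comp S : Module.End ℂ Γ.L2) 0 = ⊥ := by
  rw [eq_bot_iff]
  intro g hg
  have h1 : toL2 (S g) = 0 := by simpa using Module.End.mem_eigenspace_iff.1 hg
  have h2 : S g = 0 := toL2_injective (h1.trans (map_zero toL2).symm)
  rw [Submodule.mem_bot, ← hS.ham_apply g, h2, map_zero]

theorem rank_eigenspace_eq (hS : IsResolvent hW κ v bc α S) (μ : ℂ) :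
    Module.rank ℂ (eigenspace W v bc α μ)
      = Module.rank ℂ (Module.End.eigenspace (toL2.comp S : Module.End ℂ Γ.L2) (μ + κ)⁻¹) := by
  by_cases hμ : μ + κ = 0
  · rw [hμ, inv_zero, hS.eigenspace_zero_eq_bot]
    have h : eigenspace W v bc α μ = ⊥ := by
      rw [eq_bot_iff]
      intro f hf
      obtain ⟨y, rfl, hy1, hy2⟩ := (mem_eigenspace_iff_exists (hW := hW) (κ := κ)).1 hf
      rw [hμ, zero_smul] at hy2
      have h1 := hS.apply_ham y hy1
      rw [hy2, map_zero] at h1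
      rw [Submodule.mem_bot, ← h1, map_zero]
    rw [h, rank_bot, rank_bot]
  have hmem : ∀ g ∈ Module.End.eigenspace (toL2.comp S : Module.End ℂ Γ.L2) (μ + κ)⁻¹,
      (ofData.comp (S : Γ.L2 →ₗ[ℂ] Γ.H2Data)) g ∈ eigenspace W v bc α μ := by
    intro g hg
    have h1 : toL2 (S g) = (μ + κ)⁻¹ • g := Module.End.mem_eigenspace_iff.1 hg
    refine (mem_eigenspace_iff_exists (hW := hW) (κ := κ)).2 ⟨S g, rfl, hS.cond g, ?_⟩
    rw [hS.ham_apply, h1, smul_inv_smul₀ hμ]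
  let Λ := (ofData.comp (S : Γ.L2 →ₗ[ℂ] Γ.H2Data)).restrict hmem
  have hinj : Function.Injective Λ := by
    intro g h hgh
    have h1 : ofData (S g) = ofData (S h) := congrArg Subtype.val hgh
    have h2 := ofData_injective h1
    apply Subtype.ext
    rw [← hS.ham_apply g, h2, hS.ham_apply]
  have hsurj : Function.Surjective Λ := by
    rintro ⟨f, hf⟩
    obtain ⟨y, rfl, hy1, hy2⟩ := (mem_eigenspace_iff_exists (hW := hW) (κ := κ)).1 hf
    have h1 : S (hamL2 hW κ y) = y := hS.apply_ham y hy1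
    refine ⟨⟨hamL2 hW κ y, Module.End.mem_eigenspace_iff.2 ?_⟩, Subtype.ext ?_⟩
    · change toL2 (S (hamL2 hW κ y)) = _
      rw [h1, hy2, inv_smul_smul₀ hμ]
    · change ofData (S (hamL2 hW κ y)) = ofData y
      rw [h1]
  exact (LinearEquiv.ofBijective Λ ⟨hinj, hsurj⟩).rank_eq.symm

theorem encard_eq_rank_iff (hS : IsResolvent hW κ v bc α S) (lam : ℕ → ℝ) :
    (∀ μ : ℂ, {n : ℕ | (lam n : ℂ) = μ}.encard
      = Cardinal.toENat (Module.rank ℂ (eigenspace W v bc α μ))) ↔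
    ∀ s : ℂ, {n : ℕ | (((lam n + κ)⁻¹ : ℝ) : ℂ) = s}.encard = Cardinal.toENat
      (Module.rank ℂ (Module.End.eigenspace (toL2.comp S : Module.End ℂ Γ.L2) s)) := by
  have hset : ∀ μ : ℂ, {n : ℕ | (((lam n + κ)⁻¹ : ℝ) : ℂ) = (μ + κ)⁻¹}
      = {n : ℕ | (lam n : ℂ) = μ} := by
    intro μ
    ext n
    simp only [mem_ofPred_eq, Complex.ofReal_inv, Complex.ofReal_add, inv_inj, add_left_inj]
  constructor
  · intro h s
    have h1 := h (s⁻¹ - κ)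
    rwa [hS.rank_eigenspace_eq, ← hset, sub_add_cancel, inv_inv] at h1
  · intro h μ
    rw [hS.rank_eigenspace_eq, ← hset]
    exact h _

theorem add_pos_of_isEigenvalueSequence [Finite V] (hS : IsResolvent hW κ v bc α S)
    (hpos : ∀ g, g ≠ 0 → 0 < (inner ℂ (toL2.comp S g) g).re) {lam : ℕ → ℝ}
    (hlam : IsEigenvalueSequence W v bc α lam) (n : ℕ) : 0 < lam n + κ := by
  have h1 := (hS.encard_eq_rank_iff lam).1 hlam.2 (((lam n + κ)⁻¹ : ℝ) : ℂ)
  have h2 : Module.End.eigenspace (toL2.comp S : Module.End ℂ Γ.L2) (((lam n + κ)⁻¹ : ℝ) : ℂ)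
      ≠ ⊥ := by
    intro h0
    rw [h0, rank_bot, map_zero, encard_eq_zero] at h1
    have : n ∈ (∅ : Set ℕ) := h1 ▸ (rfl : _ = _)
    exact this
  obtain ⟨g, hg, hg0⟩ := Submodule.exists_mem_ne_zero_of_ne_bot h2
  have h3 := (eigenvalue_eq_ofReal_of_pos
    (hS.isSymmetric fun e x => Complex.conj_ofReal (W e x)) hpos hg0
    (Module.End.mem_eigenspace_iff.1 hg)).1
  rw [Complex.ofReal_re] at h3
  exact inv_pos.1 h3

theorem exists_isEigenvalueSequence [Finite V] [Nonempty E] (hS : IsResolvent hW κ v bc α S)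
    (hpos : ∀ g, g ≠ 0 → 0 < (inner ℂ (toL2.comp S g) g).re) :
    ∃ lam : ℕ → ℝ, IsEigenvalueSequence W v bc α lam := by
  have hinf : ¬ FiniteDimensional ℂ Γ.L2 := by
    intro hfd
    let e : E := Classical.arbitrary E
    apply not_finiteDimensional_segL2 (Γ.len_pos e)
    classical
    refine Module.Finite.of_surjective
      (PiLp.proj (𝕜 := ℂ) 2 (fun e => SegL2 (Γ.len e)) e : Γ.L2 →ₗ[ℂ] SegL2 (Γ.len e)) fun g => ?_
    refine ⟨WithLp.toLp 2 (Pi.single e g), ?_⟩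
    change (Pi.single e g : ∀ e, SegL2 (Γ.len e)) e = g
    simp
  obtain ⟨τ, hanti, hτ, hrank⟩ := exists_antitone_eigenvalues
    (isCompactOperator_toL2.comp_clm S : IsCompactOperator (toL2.comp S))
    (hS.isSymmetric fun e x => Complex.conj_ofReal (W e x)) hpos hinf
  refine ⟨fun n => (τ n)⁻¹ - κ, fun m n hmn => ?_, (hS.encard_eq_rank_iff _).2 ?_⟩
  · exact sub_le_sub_right (inv_anti₀ (hτ n) (hanti hmn)) κ
  · simpa only [sub_add_cancel, inv_inv] using hrank

theorem exists_hilbertBasis [Finite V] (hS : IsResolvent hW κ v bc α S)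
    (hpos : ∀ g, g ≠ 0 → 0 < (inner ℂ (toL2.comp S g) g).re) {lam : ℕ → ℝ}
    (hlam : IsEigenvalueSequence W v bc α lam) :
    Antitone (fun n => (lam n + κ)⁻¹) ∧ ∃ b : HilbertBasis ℕ ℂ Γ.L2,
      ∀ n, toL2.comp S (b n) = (((lam n + κ)⁻¹ : ℝ) : ℂ) • b n := by
  refine ⟨fun m n hmn => ?_, exists_hilbertBasis_of_encard_eq_rank
    (isCompactOperator_toL2.comp_clm S : IsCompactOperator (toL2.comp S))
    (hS.isSymmetric fun e x => Complex.conj_ofReal (W e x)) hpos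
    ((hS.encard_eq_rank_iff lam).1 hlam.2)⟩
  exact inv_anti₀ (hS.add_pos_of_isEigenvalueSequence hpos hlam m)
    (add_le_add_left (hlam.1 hmn) κ)

end IsResolvent

theorem DeltaRel.form_nonneg_of_lt {a : ℝ} {α' : WithTop ℝ} (hα : (a : WithTop ℝ) < α')
    {s t s' t' : ℂ} (h : DeltaRel a s t) (h' : DeltaRel α' s' t')
    (hle : ((s - s') * conj (t - t')).re ≤ a * ‖t - t'‖ ^ 2) :
    0 ≤ (s' * conj t - t' * conj s).re := by
  have hs : s = a * t := h
  have hsq : ‖t - t'‖ ^ 2 = ((t - t') * conj (t - t')).re := by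
    rw [Complex.mul_conj, Complex.ofReal_re, Complex.normSq_eq_norm_sq]
  rw [hsq, hs] at hle
  rw [hs]
  rcases α' with _ | a'
  · have ht : t' = 0 := h'
    rw [ht] at hle ⊢
    simp only [sub_zero, zero_mul, Complex.mul_re, Complex.sub_re, Complex.sub_im, Complex.conj_re,
      Complex.conj_im, Complex.mul_im, Complex.ofReal_re, Complex.ofReal_im] at hle ⊢
    nlinarith
  · have hs' : s' = a' * t' := h'
    have haa : a < a' := WithTop.coe_lt_coe.1 hα
    rw [hs'] at hle ⊢
    simp only [map_sub, map_mul, Complex.mul_re, Complex.sub_re, Complex.sub_im, Complex.conj_re,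
      Complex.conj_im, Complex.mul_im, Complex.ofReal_re, Complex.ofReal_im] at hle ⊢
    have h1 : (a' - a) * (t'.re ^ 2 + t'.im ^ 2) ≤ (a' - a) * (t'.re * t.re + t'.im * t.im) := by
      nlinarith
    have h2 : 0 ≤ (a' - a) * (t'.re ^ 2 + t'.im ^ 2) :=
      mul_nonneg (sub_nonneg.2 haa.le) (by positivity)
    nlinarith

theorem DeltaRel.zero (α : WithTop ℝ) : DeltaRel α 0 0 := by
  rcases α with _ | a
  · exact rfl
  · exact (mul_zero _).symm

/-- The form of the resolvent decreases when the coefficient of the `δ`-type condition grows. -/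
theorem IsResolvent.inner_le_of_lt [Finite V] {a : ℝ} {α' : WithTop ℝ} (hα : (a : WithTop ℝ) < α')
    {S' : Γ.L2 →L[ℂ] Γ.H2Data} (hS : IsResolvent hW κ v bc a S) (hS' : IsResolvent hW κ v bc α' S')
    (hform : ∀ y : Γ.H2Data, PartialConditions v bc y →
      (vder v y * conj (vval v y)).re - a * ‖vval v y‖ ^ 2
        ≤ (inner ℂ (toL2 y) (hamL2 hW κ y)).re) (g : Γ.L2) :
    (inner ℂ (toL2.comp S' g) g).re ≤ (inner ℂ (toL2.comp S g) g).re := by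
  have h1 := inner_toL2_hamL2_sub hW (fun e x => Complex.conj_ofReal (W e x)) κ (S' g) (S g)
  rw [boundary_form_eq (hS'.partialConditions g) (hS.partialConditions g), hS.ham_apply,
    hS'.ham_apply] at h1
  have h2 := hform (S g - S' g) ((hS.partialConditions g).sub (hS'.partialConditions g))
  rw [map_sub (hamL2 hW κ), hS.ham_apply, hS'.ham_apply, sub_self, inner_zero_right,
    Complex.zero_re, vder_sub, vval_sub, sub_nonpos] at h2
  have h3 := (hS.deltaRel g).form_nonneg_of_lt hα (hS'.deltaRel g) h2
  rw [← h1, Complex.sub_re] at h3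
  have h4 : (inner ℂ g (toL2 (S' g))).re = (inner ℂ (toL2 (S' g)) g).re :=
    inner_re_symm (𝕜 := ℂ) g _
  rw [h4] at h3
  exact sub_nonneg.1 h3

theorem IsResolvent.apply_eq_of_vval_eq_zero {a : ℝ} {α' : WithTop ℝ} {S' : Γ.L2 →L[ℂ] Γ.H2Data}
    (hS : IsResolvent hW κ v bc a S) (hS' : IsResolvent hW κ v bc α' S') {g : Γ.L2}
    (hg : vval v (S g) = 0) : S' g = S g := by
  have h1 : vder v (S g) = a * vval v (S g) := hS.deltaRel g
  have h2 : VertexConditions v bc α' (ofData (S g)) := by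
    refine vertexConditions_ofData_iff.2 ⟨hS.partialConditions g, ?_⟩
    rw [h1, hg, mul_zero]
    exact DeltaRel.zero α'
  have h3 := hS'.apply_ham _ h2
  rwa [hS.ham_apply] at h3

theorem eigenspace_eq_bot_of_simple [Finite V]
    (hW : ∀ e, MemLp (fun x => (W e x : ℂ)) 2 (volume.restrict (Ioc 0 (Γ.len e))))
    {a : ℝ} {α' : WithTop ℝ}
    (hα : (a : WithTop ℝ) < α') {μ : ℝ}
    (hsimple : Module.finrank ℂ (eigenspace W v bc α' (μ : ℂ)) = 1) {f : Γ.Fun}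
    (hf : f ∈ eigenspace W v bc α' (μ : ℂ))
    (hv : (∃ b : Γ.Star v, vertexVal f v b ≠ 0) ∨ ∑ b : Γ.Star v, vertexDeriv f v b ≠ 0) :
    eigenspace W v bc a (μ : ℂ) = ⊥ := by
  rw [eq_bot_iff]
  intro f₁ hf₁
  obtain ⟨y, rfl, hy1, hy2⟩ := (mem_eigenspace_iff_exists (hW := hW) (κ := 0)).1 hf
  obtain ⟨z, rfl, hz1, hz2⟩ := (mem_eigenspace_iff_exists (hW := hW) (κ := 0)).1 hf₁
  obtain ⟨hyp, hyd⟩ := vertexConditions_ofData_iff.1 hy1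
  obtain ⟨hzp, hzd⟩ := vertexConditions_ofData_iff.1 hz1
  have hzd' : vder v z = a * vval v z := hzd
  have hne : ¬ (vval v y = 0 ∧ vder v y = 0) := by
    rintro ⟨h1, h2⟩
    rcases hv with ⟨b, hb⟩ | hb
    · rw [vertexVal_ofData] at hb
      exact hb ((valueAt_eq hyp.1 b).symm.trans h1)
    · rw [vertexDeriv_ofData] at hb
      exact hb h2
  have hgreen := inner_toL2_hamL2_sub hW (fun e x => Complex.conj_ofReal (W e x)) 0 y z
  rw [boundary_form_eq hyp hzp, hy2, hz2, inner_smul_left, inner_smul_right, hzd', map_mul,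
    Complex.conj_ofReal, map_add, Complex.conj_ofReal, Complex.conj_ofReal, sub_self] at hgreen
  have hprod : (vder v y - a * vval v y) * conj (vval v z) = 0 := by
    rw [sub_mul, hgreen]
    ring
  rcases mul_eq_zero.1 hprod with h | h
  · exfalso
    rcases α' with _ | a'
    · have h1 : vval v y = 0 := hyd
      rw [h1, mul_zero, sub_zero] at h
      exact hne ⟨h1, h⟩
    · have h1 : vder v y = a' * vval v y := hyd
      have haa : a < a' := WithTop.coe_lt_coe.1 hα
      rw [h1, ← sub_mul, ← Complex.ofReal_sub] at h
      have h2 : vval v y = 0 := (mul_eq_zero.1 h).resolve_left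
        (Complex.ofReal_ne_zero.2 (sub_ne_zero.2 haa.ne'))
      exact hne ⟨h2, by rw [h1, h2, mul_zero]⟩
  · have hz0 : vval v z = 0 := (map_eq_zero _).1 h
    have hz' : ofData z ∈ eigenspace W v bc α' (μ : ℂ) := by
      refine (mem_eigenspace_iff_exists (hW := hW) (κ := 0)).2
        ⟨z, rfl, vertexConditions_ofData_iff.2 ⟨hzp, ?_⟩, hz2⟩
      rw [hzd', hz0, mul_zero]
      exact DeltaRel.zero α'
    have hy0 : (⟨ofData y, hf⟩ : eigenspace W v bc α' (μ : ℂ)) ≠ 0 := by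
      intro h0
      have h1 : y = 0 := ofData_injective
        ((congrArg Subtype.val h0).trans (map_zero ofData).symm)
      apply hne
      have h2 := vval_smul v 0 y
      have h3 := vder_smul v 0 y
      rw [zero_smul, zero_mul] at h2 h3
      rw [h1]
      exact ⟨h2, h3⟩
    obtain ⟨c, hc⟩ := (finrank_eq_one_iff_of_nonzero' _ hy0).1 hsimple ⟨ofData z, hz'⟩
    have hc' : c • y = z := by
      apply ofData_injective
      rw [map_smul]
      exact congrArg Subtype.val hc
    have h1 : c * vval v y = 0 := by rw [← vval_smul, hc', hz0]
    have h2 : c * vder v y = 0 := by rw [← vder_smul, hc', hzd', hz0, mul_zero]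
    have hc0 : c = 0 := by
      by_contra hc0
      exact hne ⟨(mul_eq_zero.1 h1).resolve_left hc0, (mul_eq_zero.1 h2).resolve_left hc0⟩
    rw [Submodule.mem_bot, ← hc', hc0, zero_smul, map_zero]

end MetricGraph

theorem theorem5p1 {V E : Type*} [Finite V] [DecidableEq V] [Fintype E] [Nonempty E]
    (Γ : MetricGraph V E) (v : V)
    (bc : ∀ u : V, u ≠ v → SelfAdjointCondition (Γ.Star u))
    (W : E → ℝ → ℝ) (hW : ∀ e, MemLp (W e) 2 (volume.restrict (Ioc 0 (Γ.len e))))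
    (α : ℝ) (α' : WithTop ℝ) (hα : (α : WithTop ℝ) < α') :
    (∃ lam : ℕ → ℝ, MetricGraph.IsEigenvalueSequence W v bc α lam) ∧
    (∃ lam' : ℕ → ℝ, MetricGraph.IsEigenvalueSequence W v bc α' lam') ∧
    ∀ lam lam' : ℕ → ℝ, MetricGraph.IsEigenvalueSequence W v bc α lam →
      MetricGraph.IsEigenvalueSequence W v bc α' lam' →
      (∀ n, lam n ≤ lam' n ∧ lam' n ≤ lam (n + 1)) ∧
      ∀ n, Module.finrank ℂ (MetricGraph.eigenspace W v bc α' (lam' n)) = 1 →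
        ∀ f ∈ MetricGraph.eigenspace W v bc α' (lam' n),
          ((∃ b : Γ.Star v, MetricGraph.vertexVal f v b ≠ 0) ∨
            ∑ b : Γ.Star v, MetricGraph.vertexDeriv f v b ≠ 0) →
          lam n < lam' n ∧ lam' n < lam (n + 1) := by
  have hWc : ∀ e, MemLp (fun x => (W e x : ℂ)) 2 (volume.restrict (Ioc 0 (Γ.len e))) :=
    fun e => (hW e).ofReal
  obtain ⟨C, hC0, hC⟩ := MetricGraph.DeltaRel.exists_form_bound α
  obtain ⟨C', hC'0, hC'⟩ := MetricGraph.DeltaRel.exists_form_bound α'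
  obtain ⟨κ, hκ⟩ := MetricGraph.exists_forall_vertex_le_form hWc v bc (C + C' + |α|)
  have hform : ∀ y : Γ.H2Data, MetricGraph.VertexConditions v bc α (MetricGraph.ofData y) →
      ‖MetricGraph.toL2 y‖ ^ 2
        ≤ (inner ℂ (MetricGraph.toL2 y) (MetricGraph.hamL2 hWc κ y)).re := by
    intro y hy
    obtain ⟨h1, h2⟩ := MetricGraph.vertexConditions_ofData_iff.1 hy
    have h3 := hκ y h1
    have h4 := hC _ _ h2
    have h5 : 0 ≤ (C' + |α|) * ‖MetricGraph.vval v y‖ ^ 2 := by positivity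
    nlinarith
  have hform' : ∀ y : Γ.H2Data, MetricGraph.VertexConditions v bc α' (MetricGraph.ofData y) →
      ‖MetricGraph.toL2 y‖ ^ 2
        ≤ (inner ℂ (MetricGraph.toL2 y) (MetricGraph.hamL2 hWc κ y)).re := by
    intro y hy
    obtain ⟨h1, h2⟩ := MetricGraph.vertexConditions_ofData_iff.1 hy
    have h3 := hκ y h1
    have h4 := hC' _ _ h2
    have h5 : 0 ≤ (C + |α|) * ‖MetricGraph.vval v y‖ ^ 2 := by positivity
    nlinarith
  obtain ⟨S, hS⟩ := MetricGraph.exists_isResolvent hform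
  obtain ⟨S', hS'⟩ := MetricGraph.exists_isResolvent hform'
  have hpos := hS.inner_pos hform
  have hpos' := hS'.inner_pos hform'
  refine ⟨hS.exists_isEigenvalueSequence hpos, hS'.exists_isEigenvalueSequence hpos',
    fun lam lam' hlam hlam' => ?_⟩
  have hreal : ∀ e x, (starRingEnd ℂ) (W e x : ℂ) = (W e x : ℂ) := fun e x =>
    Complex.conj_ofReal (W e x)
  obtain ⟨hτ, b, hb⟩ := hS.exists_hilbertBasis hpos hlam
  obtain ⟨hτ', b', hb'⟩ := hS'.exists_hilbertBasis hpos' hlam'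
  have hp := hS.add_pos_of_isEigenvalueSequence hpos hlam
  have hp' := hS'.add_pos_of_isEigenvalueSequence hpos' hlam'
  have hle : ∀ n, lam n ≤ lam' n := by
    intro n
    have h := eigenvalue_le_of_form_le (hS.isSymmetric hreal) hb hτ hb' hτ'
      (0 : Γ.L2 →ₗ[ℂ] (Fin 0 → ℂ)) (fun g _ => hS.inner_le_of_lt hα hS' (fun y hy => by
        have h1 := hκ y hy
        have h2 : 0 ≤ (C + C' + (|α| + α)) * ‖MetricGraph.vval v y‖ ^ 2 := by
          have := neg_abs_le α
          have h3 : 0 ≤ |α| + α := by linarith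
          positivity
        nlinarith [sq_nonneg ‖MetricGraph.toL2 y‖]) g) n
    have h' := (inv_le_inv₀ (hp' n) (hp n)).1 h
    linarith
  have hle' : ∀ n, lam' n ≤ lam (n + 1) := by
    intro n
    obtain ⟨ℓ, hℓ⟩ := MetricGraph.exists_vval_linear (Γ := Γ) v
    have h := eigenvalue_le_of_form_le (hS'.isSymmetric hreal) hb' hτ' hb hτ
      (LinearMap.pi fun _ : Fin 1 => ℓ.comp (S : Γ.L2 →ₗ[ℂ] Γ.H2Data)) (fun g hg => by
        have h1 : MetricGraph.vval v (S g) = 0 := by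
          rw [← hℓ]
          exact congrFun hg 0
        rw [ContinuousLinearMap.comp_apply, ContinuousLinearMap.comp_apply,
          hS.apply_eq_of_vval_eq_zero hS' h1]) n
    have h' := (inv_le_inv₀ (hp (n + 1)) (hp' n)).1 h
    linarith
  refine ⟨fun n => ⟨hle n, hle' n⟩, fun n hn f hf hv => ?_⟩
  have hbot := MetricGraph.eigenspace_eq_bot_of_simple hWc hα hn hf hv
  have hne : ∀ m, lam m ≠ lam' n := by
    intro m hm
    have h := hlam.2 (lam' n : ℂ)
    rw [hbot, rank_bot, map_zero, encard_eq_zero] at h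
    have hmem : m ∈ {k : ℕ | (lam k : ℂ) = (lam' n : ℂ)} := congrArg Complex.ofReal hm
    rw [h] at hmem
    exact hmem
  exact ⟨lt_of_le_of_ne (hle n) (hne n), lt_of_le_of_ne (hle' n) (hne (n + 1)).symm⟩
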